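/- Let $(M,g)$ be a smooth, finite-dimensional Riemannian manifold without boundary, with Levi-Civita connection $\nabla$, and let $f:M\to(0,\infty)$ be a smooth function. Let $\operatorname{grad} f$ be its gradient with respect to $g$, and put $\|v\|=\sqrt{g(v,v)}$ and $\alpha=1+\|\operatorname{grad}f\|^2$. For a tangent vector $X=X^i\frac{\partial}{\partial x^i}$ at $x\in M$ and $p=(x,u)\in TM$, let $X^V=X^i\frac{\partial}{\partial y^i}$ and $X^H=X^i\big(\frac{\partial}{\partial x^i}-\Gamma_{ij}^k u^j\frac{\partial}{\partial y^k}\big)$ be its vertical and horizontal lifts at $p$ (in the coordinates $(x^i,y^i)$ of $TM$ induced by coordinates $(x^i)$ of $M$, with $\Gamma_{ij}^k$ the Christoffel symbols of $g$). The Mus-Gradient metric $g^f$ on the tangent bundle $TM$ is given at $p=(x,u)$ by $$g^f(X^H,Y^H)=g_x(X,Y),\qquad g^f(X^H,Y^V)=0,\qquad g^f(X^V,Y^V)=g_x(X,Y)+X(f)\,Y(f).$$ For a smooth map $\varphi$ from $(N,h)$ to $(M,g)$ the tension field is $\tau(\varphi)=\operatorname{Tr}_h\nabla d\varphi$, and $\varphi$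 is harmonic if $\tau(\varphi)=0$. Then the tension field of the canonical projection $\pi:(TM,g^f)\to(M,g)$ is, at every $p=(x,u)\in TM$, $$\tau(\pi)_p=\Big(\frac1\alpha\nabla_{\operatorname{grad}f}\operatorname{grad}f\Big)_x=\Big(\frac{\operatorname{grad}\alpha}{2\alpha}\Big)_x .$$ Moreover, if $M$ is connected, then $\pi$ is harmonic if and only if $\|\operatorname{grad} f\|$ is constant on $M$. -/

import Mathlib

open Bundle Set Manifold
open scoped ContDiff Topology

noncomputable section

namespace RiemGeom

/-! ### Linear algebra -/

section LinearAlgebra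

variable {V W : Type*} [NormedAddCommGroup V] [NormedSpace ℝ V] [FiniteDimensional ℝ V]
  [NormedAddCommGroup W] [NormedSpace ℝ W]

/-- The trace of a bilinear map `B : V × V → W` with respect to an inner product `G` on `V`:
in terms of a basis `bᵢ` with dual basis `bⁱ`, it is `∑ᵢ B(bᵢ, ♯bⁱ) = ∑ᵢⱼ Gⁱʲ B(bᵢ, bⱼ)`, where
`♯ : V* → V` is the inverse of `v ↦ G(v, ·)`. It does not depend on the basis, and it is
`∑ᵢ B(eᵢ, eᵢ)` for every orthonormal basis, see `metricTrace_eq_sum_orthonormal`. -/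
def metricTrace (G : V →L[ℝ] V →L[ℝ] ℝ) (B : V →L[ℝ] V →L[ℝ] W) : W :=
  ∑ i, B (Module.finBasis ℝ V i)
    (G.inverse (LinearMap.toContinuousLinearMap ((Module.finBasis ℝ V).coord i)))

theorem isInvertible_of_pos {G : V →L[ℝ] V →L[ℝ] ℝ} (hG : ∀ v, v ≠ 0 → 0 < G v v) :
    G.IsInvertible := by
  have hinj : Function.Injective (G : V →ₗ[ℝ] V →L[ℝ] ℝ) := by
    rw [← LinearMap.ker_eq_bot, LinearMap.ker_eq_bot']
    intro v hv
    by_contra h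
    have h1 := hG v h
    have h2 : G v = 0 := hv
    simp [h2] at h1
  have hdim : Module.finrank ℝ V = Module.finrank ℝ (V →L[ℝ] ℝ) := by
    rw [← (LinearMap.toContinuousLinearMap (𝕜 := ℝ) (E := V) (F' := ℝ)).finrank_eq]
    exact (Subspace.dual_finrank_eq (K := ℝ) (V := V)).symm
  let e := LinearEquiv.ofInjectiveOfFinrankEq (G : V →ₗ[ℝ] V →L[ℝ] ℝ) hinj hdim
  exact ⟨e.toContinuousLinearEquiv, by ext v w; rfl⟩

theorem apply_inverse {G : V →L[ℝ] V →L[ℝ] ℝ} (hG : ∀ v, v ≠ 0 → 0 < G v v)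
    (l : V →L[ℝ] ℝ) : G (G.inverse l) = l :=
  ((isInvertible_of_pos hG).inverse_apply_eq.1 rfl).symm

theorem metricTrace_eq_sum_orthonormal {ι : Type*} [Fintype ι] [DecidableEq ι]
    {G : V →L[ℝ] V →L[ℝ] ℝ} (hG : ∀ v, v ≠ 0 → 0 < G v v) (B : V →L[ℝ] V →L[ℝ] W)
    (e : Module.Basis ι ℝ V) (he : ∀ i j, G (e i) (e j) = if i = j then 1 else 0) :
    metricTrace G B = ∑ i, B (e i) (e i) := by
  have hrepr : ∀ v, v = ∑ j, G v (e j) • e j := by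
    intro v
    have : ∀ j, G v (e j) = e.repr v j := by
      intro j
      conv_lhs => rw [← e.sum_repr v, map_sum, sum_apply]
      simp [he, -Module.Basis.sum_repr]
    simp [this, e.sum_repr]
  unfold metricTrace
  set b := Module.finBasis ℝ V
  have h1 : ∀ i, G.inverse (LinearMap.toContinuousLinearMap (b.coord i)) =
      ∑ j, b.repr (e j) i • e j := by
    intro i
    rw [hrepr (G.inverse _)]
    simp [apply_inverse hG]
  simp_rw [h1, map_sum, map_smul]
  rw [Finset.sum_comm]
  refine Finset.sum_congr rfl fun j _ => ?_
  have h2 := congrArg (fun v => B v (e j)) (b.sum_repr (e j))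
  simp only [map_sum, map_smul, sum_apply, smul_apply] at h2
  exact h2

/-- The unit ball of an inner product on a finite dimensional space is bounded. -/
theorem isVonNBounded_of_pos {G : V →L[ℝ] V →L[ℝ] ℝ} (hG : ∀ v, v ≠ 0 → 0 < G v v) :
    Bornology.IsVonNBounded ℝ {v : V | G v v < 1} := by
  rw [NormedSpace.isVonNBounded_iff]
  have hc : Continuous fun v => G v v := by fun_prop
  have hK : IsCompact (Metric.sphere (0 : V) 1) := isCompact_sphere 0 1
  obtain hempty | hne := (Metric.sphere (0 : V) 1).eq_empty_or_nonempty
  · have h0 : ∀ v : V, v = 0 := by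
      intro v
      by_contra hv
      have : ‖v‖⁻¹ • v ∈ Metric.sphere (0 : V) 1 := by
        simp [norm_smul, norm_ne_zero_iff.2 hv]
      rw [hempty] at this
      exact this
    exact Bornology.IsBounded.subset (Bornology.isBounded_singleton (x := (0 : V)))
      fun v _ => h0 v
  · obtain ⟨w, hw, hmin⟩ := hK.exists_isMinOn hne hc.continuousOn
    have hw0 : w ≠ 0 := by
      rintro rfl
      simp at hw
    have hm := hG w hw0
    refine (Metric.isBounded_iff_subset_closedBall (0 : V)).2 ⟨1 / (G w w) + 1, fun v hv => ?_⟩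
    rw [mem_closedBall_zero_iff]
    by_cases hv0 : v = 0
    · simp only [hv0, norm_zero]
      positivity
    have hn : 0 < ‖v‖ := norm_pos_iff.2 hv0
    have hmem : ‖v‖⁻¹ • v ∈ Metric.sphere (0 : V) 1 := by
      simp [norm_smul, hn.ne']
    have h1 : G w w ≤ G (‖v‖⁻¹ • v) (‖v‖⁻¹ • v) := hmin hmem
    simp only [map_smul, smul_apply, smul_eq_mul] at h1
    have h2 : G w w * ‖v‖ ^ 2 ≤ G v v := by
      calc G w w * ‖v‖ ^ 2 ≤ (‖v‖⁻¹ * (‖v‖⁻¹ * G v v)) * ‖v‖ ^ 2 := by gcongr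
        _ = G v v := by field_simp
    have h3 : G v v < 1 := hv
    have h4 : ‖v‖ ^ 2 ≤ 1 / G w w := by
      rw [le_div_iff₀ hm]
      nlinarith
    nlinarith [sq_nonneg (‖v‖ - 1)]

end LinearAlgebra

/-! ### Riemannian geometry in charts

`M` is a manifold without boundary, modelled on the real vector space `E`. As everywhere in
Mathlib, the tangent space `TangentSpace I x` is the vector space `E`, a vector at `x` being
identified with its coordinates in the preferred chart `extChartAt I x` at `x`. Tensorial objects
at `x` are defined below by their usual coordinate expression in that chart. -/

section Charts

variable {E : Type*} [NormedAddCommGroup E] [NormedSpace ℝ E]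
  {H : Type*} [TopologicalSpace H] {I : ModelWithCorners ℝ E H}
  {M : Type*} [TopologicalSpace M] [ChartedSpace H M]

/-- The coordinate expression of a metric in the chart at `c`, as a function of the coordinates
`y`: the pull-back of the metric by the inverse of the chart. Its values are the bilinear forms
`(v, w) ↦ gᵢⱼ(y) vⁱ wʲ`. -/
def chartMetric (g : RiemannianMetric (fun x : M => TangentSpace I x)) (c : M) (y : E) :
    E →L[ℝ] E →L[ℝ] ℝ :=
  let A : E →L[ℝ] E := mfderiv 𝓘(ℝ, E) I (extChartAt I c).symm y
  let G : E →L[ℝ] E →L[ℝ] ℝ := g.inner ((extChartAt I c).symm y)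
  G.bilinearComp A A

set_option synthInstance.maxHeartbeats 200000 in
/-- The Christoffel symbols `(v, w) ↦ Γᵏᵢⱼ(y) vⁱ wʲ` of the Levi-Civita connection in the chart at
`c`, at the point with coordinates `y`: `Γ(v, w)` is the vector such that
`g(Γ(v, w), z) = ½ (∂ᵥ g(w, z) + ∂_w g(v, z) - ∂_z g(v, w))` for all `z`,
see `chartMetric_christoffel`. -/
def christoffel (g : RiemannianMetric (fun x : M => TangentSpace I x)) (c : M) (y : E) :
    E →L[ℝ] E →L[ℝ] E :=
  let S : (E →L[ℝ] ℝ) →L[ℝ] E := (chartMetric g c y).inverse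
  let D : E →L[ℝ] E →L[ℝ] E →L[ℝ] ℝ := fderiv ℝ (chartMetric g c) y
  let F : (E →L[ℝ] E →L[ℝ] ℝ) →L[ℝ] E →L[ℝ] E →L[ℝ] ℝ :=
    (ContinuousLinearMap.flipₗᵢ ℝ E E ℝ).toContinuousLinearEquiv
  let A : E →L[ℝ] E →L[ℝ] E := (ContinuousLinearMap.compL ℝ E (E →L[ℝ] ℝ) E S) ∘L D
  let C : E →L[ℝ] E →L[ℝ] E := (ContinuousLinearMap.compL ℝ E (E →L[ℝ] ℝ) E S) ∘L (F ∘L D.flip)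
  (1 / 2 : ℝ) • (A + A.flip - C)

set_option synthInstance.maxHeartbeats 200000 in
theorem christoffel_apply (g : RiemannianMetric (fun x : M => TangentSpace I x)) (c : M)
    (y v w : E) :
    christoffel g c y v w = (1 / 2 : ℝ) • ((chartMetric g c y).inverse
      (fderiv ℝ (chartMetric g c) y v w) + (chartMetric g c y).inverse
      (fderiv ℝ (chartMetric g c) y w v) - (chartMetric g c y).inverse
      (((fderiv ℝ (chartMetric g c) y).flip v).flip w)) := rfl

theorem chartMetric_christoffel [FiniteDimensional ℝ E]
    (g : RiemannianMetric (fun x : M => TangentSpace I x)) (c : M) (y v w z : E)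
    (hy : ∀ v, v ≠ 0 → 0 < chartMetric g c y v v) :
    chartMetric g c y (christoffel g c y v w) z =
      1 / 2 * (fderiv ℝ (chartMetric g c) y v w z + fderiv ℝ (chartMetric g c) y w v z -
        fderiv ℝ (chartMetric g c) y z v w) := by
  rw [christoffel_apply]
  simp only [map_smul, map_add, map_sub, apply_inverse hy, smul_apply, add_apply, sub_apply,
    ContinuousLinearMap.flip_apply, smul_eq_mul]

/-- The Christoffel symbols at the point `x`, in the chart at `x`. -/
def christoffelAt (g : RiemannianMetric (fun x : M => TangentSpace I x)) (x : M) :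
    E →L[ℝ] E →L[ℝ] E :=
  christoffel g x (extChartAt I x x)

/-- The gradient of a function: `g(grad f, ·) = df`. -/
def gradient (g : RiemannianMetric (fun x : M => TangentSpace I x)) (f : M → ℝ) (x : M) :
    TangentSpace I x :=
  (g.inner x).inverse (mfderiv I 𝓘(ℝ, ℝ) f x)

/-- The differential of a real function, applied to a tangent vector: `X(f)`. -/
def dirDeriv (f : M → ℝ) (x : M) (X : TangentSpace I x) : ℝ := mfderiv I 𝓘(ℝ, ℝ) f x X

/-- The coordinate expression of a vector field in the chart at `c`. -/
def chartField (c : M) (Y : Π x : M, TangentSpace I x) (y : E) : E :=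
  mfderiv I 𝓘(ℝ, E) (extChartAt I c) ((extChartAt I c).symm y) (Y ((extChartAt I c).symm y))

/-- The Levi-Civita covariant derivative `(∇ᵥ Y)ᵏ = ∂ᵥ Yᵏ + Γᵏᵢⱼ vⁱ Yʲ` of a vector field `Y` in
the direction of a tangent vector `v` at `x`. -/
def covDeriv (g : RiemannianMetric (fun x : M => TangentSpace I x))
    (Y : Π x : M, TangentSpace I x) (x : M) (v : TangentSpace I x) : TangentSpace I x :=
  (fderiv ℝ (chartField x Y) (extChartAt I x x) v + christoffelAt g x v (Y x) : E)

/-- The length of a tangent vector. -/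
def metricNorm (g : RiemannianMetric (fun x : M => TangentSpace I x)) (x : M)
    (v : TangentSpace I x) : ℝ :=
  Real.sqrt (g.inner x v v)

end Charts

/-! ### Harmonic maps -/

section Tension

variable {E' : Type*} [NormedAddCommGroup E'] [NormedSpace ℝ E']
  {H' : Type*} [TopologicalSpace H'] {I' : ModelWithCorners ℝ E' H'}
  {N : Type*} [TopologicalSpace N] [ChartedSpace H' N]
  {E : Type*} [NormedAddCommGroup E] [NormedSpace ℝ E]
  {H : Type*} [TopologicalSpace H] {I : ModelWithCorners ℝ E H}
  {M : Type*} [TopologicalSpace M] [ChartedSpace H M]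

/-- The second fundamental form `∇dφ` of a map `φ : (N, h) → (M, g)` at `p`, in the charts at `p`
and at `φ p`. With `Φ` the coordinate expression of `φ`,
`∇dφ(v, w) = D²Φ(v, w) + Γᵍ(DΦ v, DΦ w) - DΦ(Γʰ(v, w))`. -/
def secondFundamentalForm (h : RiemannianMetric (fun p : N => TangentSpace I' p))
    (g : RiemannianMetric (fun x : M => TangentSpace I x)) (φ : N → M) (p : N) :
    E' →L[ℝ] E' →L[ℝ] E :=
  let Φ : E' → E := writtenInExtChartAt I' I p φ
  let y : E' := extChartAt I' p p
  fderiv ℝ (fderiv ℝ Φ) y + (christoffelAt g (φ p)).bilinearComp (fderiv ℝ Φ y) (fderiv ℝ Φ y) -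
    (ContinuousLinearMap.compL ℝ E' E' E (fderiv ℝ Φ y)) ∘L christoffelAt h p

theorem secondFundamentalForm_apply (h : RiemannianMetric (fun p : N => TangentSpace I' p))
    (g : RiemannianMetric (fun x : M => TangentSpace I x)) (φ : N → M) (p : N) (v w : E') :
    secondFundamentalForm h g φ p v w =
      fderiv ℝ (fderiv ℝ (writtenInExtChartAt I' I p φ)) (extChartAt I' p p) v w +
        christoffelAt g (φ p) (fderiv ℝ (writtenInExtChartAt I' I p φ) (extChartAt I' p p) v)
          (fderiv ℝ (writtenInExtChartAt I' I p φ) (extChartAt I' p p) w) -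
        fderiv ℝ (writtenInExtChartAt I' I p φ) (extChartAt I' p p) (christoffelAt h p v w) := rfl

variable [FiniteDimensional ℝ E']

/-- The tension field `τ(φ) = Tr_h ∇dφ`, a vector field along `φ : (N, h) → (M, g)`. -/
def tensionField (h : RiemannianMetric (fun p : N => TangentSpace I' p))
    (g : RiemannianMetric (fun x : M => TangentSpace I x)) (φ : N → M) (p : N) :
    TangentSpace I (φ p) :=
  (metricTrace (V := E') (h.inner p) (secondFundamentalForm h g φ p) : E)

/-- A smooth map is harmonic if its tension field vanishes. -/
def IsHarmonic (h : RiemannianMetric (fun p : N => TangentSpace I' p))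
    (g : RiemannianMetric (fun x : M => TangentSpace I x)) (φ : N → M) : Prop :=
  ContMDiff I' I ∞ φ ∧ ∀ p, tensionField h g φ p = 0

end Tension

/-! ### The Mus-Gradient metric on the tangent bundle -/

section TangentBundle

variable {E : Type*} [NormedAddCommGroup E] [NormedSpace ℝ E]
  {H : Type*} [TopologicalSpace H] {I : ModelWithCorners ℝ E H}
  {M : Type*} [TopologicalSpace M] [ChartedSpace H M] [IsManifold I ∞ M]

/-- The horizontal lift of `X` at `p = (x, u)`. In the coordinates `(xⁱ, yⁱ)` of the tangent bundle
induced by the chart at `x`, it is `Xⁱ (∂/∂xⁱ - Γᵏᵢⱼ uʲ ∂/∂yᵏ)`. -/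
def horizontalLift (g : RiemannianMetric (fun x : M => TangentSpace I x)) (p : TangentBundle I M)
    (X : TangentSpace I p.proj) : TangentSpace I.tangent p :=
  ((X, -christoffelAt g p.proj X p.snd) : E × E)

/-- The vertical lift `Xⁱ ∂/∂yⁱ` of `X` at `p = (x, u)`. -/
def verticalLift (p : TangentBundle I M) (X : TangentSpace I p.proj) : TangentSpace I.tangent p :=
  ((0, X) : E × E)

/-- The vector `a` in the decomposition `ξ = a^H + b^V` of a vector `ξ` tangent to `TM`. -/
def horizontalPart (p : TangentBundle I M) :
    TangentSpace I.tangent p →L[ℝ] TangentSpace I p.proj :=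
  (ContinuousLinearMap.fst ℝ E E : E × E →L[ℝ] E)

/-- The vector `b` in the decomposition `ξ = a^H + b^V` of a vector `ξ` tangent to `TM`. -/
def verticalPart (g : RiemannianMetric (fun x : M => TangentSpace I x)) (p : TangentBundle I M) :
    TangentSpace I.tangent p →L[ℝ] TangentSpace I p.proj :=
  (ContinuousLinearMap.snd ℝ E E +
    (christoffelAt g p.proj).flip p.snd ∘L ContinuousLinearMap.fst ℝ E E : E × E →L[ℝ] E)

theorem horizontalPart_horizontalLift (g : RiemannianMetric (fun x : M => TangentSpace I x))
    (p : TangentBundle I M) (X : TangentSpace I p.proj) :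
    horizontalPart p (horizontalLift g p X) = X := rfl

theorem horizontalPart_verticalLift (p : TangentBundle I M) (X : TangentSpace I p.proj) :
    horizontalPart p (verticalLift p X) = 0 := rfl

theorem verticalPart_horizontalLift (g : RiemannianMetric (fun x : M => TangentSpace I x))
    (p : TangentBundle I M) (X : TangentSpace I p.proj) :
    verticalPart g p (horizontalLift g p X) = 0 :=
  neg_add_cancel (christoffelAt g p.proj X p.snd)

theorem verticalPart_verticalLift (g : RiemannianMetric (fun x : M => TangentSpace I x))
    (p : TangentBundle I M) (X : TangentSpace I p.proj) :
    verticalPart g p (verticalLift p X) = X := by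
  have h : ∀ X : E, X + christoffelAt g p.proj (0 : E) p.snd = X := fun X => by
    rw [map_zero]; exact add_zero X
  exact h X

theorem eq_horizontalLift_add_verticalLift
    (g : RiemannianMetric (fun x : M => TangentSpace I x)) (p : TangentBundle I M)
    (ξ : TangentSpace I.tangent p) :
    ξ = horizontalLift g p (horizontalPart p ξ) + verticalLift p (verticalPart g p ξ) := by
  obtain ⟨a, b⟩ : E × E := ξ
  have h : ((a, b) : E × E) = (a, -christoffelAt g p.proj a p.snd) +
      (0, b + christoffelAt g p.proj a p.snd) := by
    simp
  exact h

/-- The bilinear form of the Mus-Gradient metric `g^f`: for `ξ = X^H + Z^V`, `η = Y^H + W^V`,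
`g^f(ξ, η) = g(X, Y) + g(Z, W) + Z(f) W(f)`. -/
def musGradientForm (g : RiemannianMetric (fun x : M => TangentSpace I x)) (f : M → ℝ)
    (p : TangentBundle I M) :
    TangentSpace I.tangent p →L[ℝ] TangentSpace I.tangent p →L[ℝ] ℝ :=
  let G : E →L[ℝ] E →L[ℝ] ℝ := g.inner p.proj
  let df : E →L[ℝ] ℝ := mfderiv I 𝓘(ℝ, ℝ) f p.proj
  let P : E × E →L[ℝ] E := horizontalPart p
  let K : E × E →L[ℝ] E := verticalPart g p
  (G.bilinearComp P P + G.bilinearComp K K + (df ∘L K).smulRight (df ∘L K) :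
    E × E →L[ℝ] E × E →L[ℝ] ℝ)

theorem musGradientForm_apply (g : RiemannianMetric (fun x : M => TangentSpace I x)) (f : M → ℝ)
    (p : TangentBundle I M) (ξ η : TangentSpace I.tangent p) :
    musGradientForm g f p ξ η =
      g.inner p.proj (horizontalPart p ξ) (horizontalPart p η) +
      (g.inner p.proj (verticalPart g p ξ) (verticalPart g p η) +
        dirDeriv f p.proj (verticalPart g p ξ) * dirDeriv f p.proj (verticalPart g p η)) :=
  add_assoc _ _ _

theorem musGradientForm_pos (g : RiemannianMetric (fun x : M => TangentSpace I x)) (f : M → ℝ)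
    (p : TangentBundle I M) (ξ : TangentSpace I.tangent p) (hξ : ξ ≠ 0) :
    0 < musGradientForm g f p ξ ξ := by
  have hnn : ∀ v : TangentSpace I p.proj, 0 ≤ g.inner p.proj v v := fun v => by
    by_cases hv : v = 0
    · simp [hv]
    · exact (g.pos _ v hv).le
  rw [musGradientForm_apply]
  have h1 := hnn (horizontalPart p ξ)
  have h2 := hnn (verticalPart g p ξ)
  have h3 := mul_self_nonneg (dirDeriv f p.proj (verticalPart g p ξ))
  by_cases ha : horizontalPart p ξ = 0
  · have hb : verticalPart g p ξ ≠ 0 := by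
      intro hb
      apply hξ
      rw [eq_horizontalLift_add_verticalLift g p ξ, ha, hb]
      have h : ((0, -christoffelAt g p.proj 0 p.snd) : E × E) + (0, 0) = 0 := by
        rw [map_zero]
        exact (congrArg (fun e : E => ((0, e) : E × E) + (0, 0)) neg_zero).trans (by simp)
      exact h
    have := g.pos _ _ hb
    linarith
  · have := g.pos _ _ ha
    linarith

variable [FiniteDimensional ℝ E]

/-- The Mus-Gradient metric `g^f` on the tangent bundle. -/
def musGradientMetric (g : RiemannianMetric (fun x : M => TangentSpace I x)) (f : M → ℝ) :
    RiemannianMetric (fun p : TangentBundle I M => TangentSpace I.tangent p) where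
  inner := musGradientForm g f
  symm p ξ η := by
    simp only [musGradientForm_apply, g.symm p.proj]
    rw [g.symm p.proj (horizontalPart p ξ), g.symm p.proj (verticalPart g p ξ)]
    ring
  pos := musGradientForm_pos g f
  continuousAt p := by
    have h : ∀ B : E × E →L[ℝ] E × E →L[ℝ] ℝ, Continuous fun v => B v v := fun B => by fun_prop
    exact (h (musGradientForm g f p)).continuousAt
  isVonNBounded p := isVonNBounded_of_pos (V := E × E) (musGradientForm_pos g f p)

theorem musGradientMetric_horizontal_horizontal
    (g : RiemannianMetric (fun x : M => TangentSpace I x)) (f : M → ℝ) (p : TangentBundle I M)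
    (X Y : TangentSpace I p.proj) :
    (musGradientMetric g f).inner p (horizontalLift g p X) (horizontalLift g p Y) =
      g.inner p.proj X Y := by
  change musGradientForm g f p _ _ = _
  rw [musGradientForm_apply]
  have h : dirDeriv f p.proj (0 : TangentSpace I p.proj) = 0 := map_zero _
  simp [verticalPart_horizontalLift, horizontalPart_horizontalLift, h]

theorem musGradientMetric_horizontal_vertical
    (g : RiemannianMetric (fun x : M => TangentSpace I x)) (f : M → ℝ) (p : TangentBundle I M)
    (X Y : TangentSpace I p.proj) :
    (musGradientMetric g f).inner p (horizontalLift g p X) (verticalLift p Y) = 0 := by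
  change musGradientForm g f p _ _ = _
  rw [musGradientForm_apply]
  have h : dirDeriv f p.proj (0 : TangentSpace I p.proj) = 0 := map_zero _
  simp [verticalPart_horizontalLift, horizontalPart_verticalLift, h]

theorem musGradientMetric_vertical_vertical
    (g : RiemannianMetric (fun x : M => TangentSpace I x)) (f : M → ℝ) (p : TangentBundle I M)
    (X Y : TangentSpace I p.proj) :
    (musGradientMetric g f).inner p (verticalLift p X) (verticalLift p Y) =
      g.inner p.proj X Y + dirDeriv f p.proj X * dirDeriv f p.proj Y := by
  change musGradientForm g f p _ _ = _
  rw [musGradientForm_apply]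
  simp [verticalPart_verticalLift, horizontalPart_verticalLift]

/-- The function `α = 1 + g(grad f, grad f)`. -/
def alpha (g : RiemannianMetric (fun x : M => TangentSpace I x)) (f : M → ℝ) (x : M) : ℝ :=
  1 + g.inner x (gradient g f x) (gradient g f x)

end TangentBundle

end RiemGeom

end

noncomputable section

namespace RiemGeom

/-! ### Changes of charts -/

section ChartTransition

variable {E : Type*} [NormedAddCommGroup E] [NormedSpace ℝ E]
  {H : Type*} [TopologicalSpace H] {I : ModelWithCorners ℝ E H}
  {M : Type*} [TopologicalSpace M] [ChartedSpace H M]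

variable (I) in
/-- The change of coordinates from the chart at `c` to the chart at `d`. -/
def chartTransition (c d : M) (y : E) : E := extChartAt I d ((extChartAt I c).symm y)

variable (I) in
/-- The coordinates, in the chart at `c`, of the points which belong to the chart at `d`. -/
def overlap (c d : M) : Set E :=
  (extChartAt I c).target ∩ (extChartAt I c).symm ⁻¹' (extChartAt I d).source

theorem mem_overlap_point {c : M} {y : E} (hy : y ∈ (extChartAt I c).target) :
    y ∈ overlap I c ((extChartAt I c).symm y) :=
  ⟨hy, mem_extChartAt_source _⟩

theorem symm_chartTransition {c d : M} {y : E} (hy : y ∈ overlap I c d) :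
    (extChartAt I d).symm (chartTransition I c d y) = (extChartAt I c).symm y :=
  (extChartAt I d).left_inv hy.2

theorem chartTransition_mem_overlap {c d : M} {y : E} (hy : y ∈ overlap I c d) :
    chartTransition I c d y ∈ overlap I d c := by
  refine ⟨(extChartAt I d).map_source hy.2, ?_⟩
  rw [mem_preimage, symm_chartTransition hy]
  exact (extChartAt I c).map_target hy.1

theorem chartTransition_chartTransition {c d : M} {y : E} (hy : y ∈ overlap I c d) :
    chartTransition I d c (chartTransition I c d y) = y := by
  unfold chartTransition
  rw [(extChartAt I d).left_inv hy.2, (extChartAt I c).right_inv hy.1]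

variable [I.Boundaryless]

theorem isOpen_overlap (c d : M) : IsOpen (overlap I c d) :=
  (continuousOn_extChartAt_symm c).isOpen_inter_preimage (isOpen_extChartAt_target c)
    (isOpen_extChartAt_source d)

theorem fderiv_chartTransition_self {c : M} {y : E} (hy : y ∈ (extChartAt I c).target) (v : E) :
    fderiv ℝ (chartTransition I c c) y v = v := by
  have h2 : chartTransition I c c =ᶠ[𝓝 y] id := by
    filter_upwards [(isOpen_extChartAt_target c).mem_nhds hy] with z hz
    exact (extChartAt I c).right_inv hz
  rw [h2.fderiv_eq, fderiv_id]
  rfl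

variable [IsManifold I ∞ M]

theorem contDiffAt_chartTransition {c d : M} {y : E} (hy : y ∈ overlap I c d) :
    ContDiffAt ℝ ∞ (chartTransition I c d) y := by
  have h := contDiffWithinAt_ext_coord_change (I := I) (n := ∞) d c (y := y)
    (by rw [PartialEquiv.trans_source, PartialEquiv.symm_source]; exact hy)
  rwa [I.range_eq_univ, contDiffWithinAt_univ] at h

theorem differentiableAt_chartTransition {c d : M} {y : E} (hy : y ∈ overlap I c d) :
    DifferentiableAt ℝ (chartTransition I c d) y :=
  (contDiffAt_chartTransition hy).differentiableAt (by simp)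

theorem differentiableAt_fderiv_chartTransition {c d : M} {y : E} (hy : y ∈ overlap I c d) :
    DifferentiableAt ℝ (fderiv ℝ (chartTransition I c d)) y :=
  ((contDiffAt_chartTransition hy).fderiv_right (m := 1) (by norm_cast)).differentiableAt
    (by simp)

theorem fderiv_chartTransition_symm {c d : M} {y : E} (hy : y ∈ overlap I c d) (v w : E) :
    fderiv ℝ (fderiv ℝ (chartTransition I c d)) y v w =
      fderiv ℝ (fderiv ℝ (chartTransition I c d)) y w v :=
  ((contDiffAt_chartTransition hy).isSymmSndFDerivAt
    (by simp only [minSmoothness_of_isRCLikeNormedField]; norm_cast)) v w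

theorem fderiv_chartTransition_comp {c d : M} {y : E} (hy : y ∈ overlap I c d) (v : E) :
    fderiv ℝ (chartTransition I d c) (chartTransition I c d y)
      (fderiv ℝ (chartTransition I c d) y v) = v := by
  have h1 := (differentiableAt_chartTransition (chartTransition_mem_overlap hy)).hasFDerivAt.comp y
    (differentiableAt_chartTransition hy).hasFDerivAt
  have h2 : (chartTransition I d c ∘ chartTransition I c d) =ᶠ[𝓝 y] id := by
    filter_upwards [(isOpen_overlap c d).mem_nhds hy] with z hz
    exact chartTransition_chartTransition hz
  exact congrArg (fun T : E →L[ℝ] E => T v) (h1.unique ((hasFDerivAt_id y).congr_of_eventuallyEq h2))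

theorem fderiv_chartTransition_comp' {c d : M} {y : E} (hy : y ∈ overlap I c d) (v : E) :
    fderiv ℝ (chartTransition I c d) y
      (fderiv ℝ (chartTransition I d c) (chartTransition I c d y) v) = v := by
  have h := fderiv_chartTransition_comp (chartTransition_mem_overlap hy) v
  rwa [chartTransition_chartTransition hy] at h

theorem mdifferentiableAt_extChartAt_symm {c : M} {y : E} (hy : y ∈ (extChartAt I c).target) :
    MDifferentiableAt 𝓘(ℝ, E) I (extChartAt I c).symm y := by
  have h := mdifferentiableWithinAt_extChartAt_symm hy
  rwa [I.range_eq_univ, mdifferentiableWithinAt_univ] at h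

theorem mfderiv_extChartAt_symm {c : M} {y : E} (hy : y ∈ (extChartAt I c).target) :
    (mfderiv 𝓘(ℝ, E) I (extChartAt I c).symm y : E →L[ℝ] E) =
      fderiv ℝ (chartTransition I c ((extChartAt I c).symm y)) y := by
  refine (mdifferentiableAt_extChartAt_symm hy).mfderiv.trans ?_
  simp only [writtenInExtChartAt, extChartAt_model_space_eq_id, PartialEquiv.refl_coe,
    PartialEquiv.refl_symm, modelWithCornersSelf_coe, range_id, fderivWithin_univ]
  rfl

theorem mfderiv_extChartAt_eq_fderiv {c q : M} (hq : q ∈ (extChartAt I c).source) :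
    (mfderiv I 𝓘(ℝ, E) (extChartAt I c) q : E →L[ℝ] E) =
      fderiv ℝ (chartTransition I q c) (extChartAt I q q) := by
  refine (mdifferentiableAt_extChartAt (by simpa using hq)).mfderiv.trans ?_
  simp only [writtenInExtChartAt, extChartAt_model_space_eq_id, PartialEquiv.refl_coe, I.range_eq_univ,
    fderivWithin_univ]
  rfl

theorem fderiv_chartTransition_trans {c d e : M} {y : E} (hy : y ∈ overlap I c d)
    (hy' : y ∈ overlap I c e) (v : E) :
    fderiv ℝ (chartTransition I c e) y v = fderiv ℝ (chartTransition I d e)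
      (chartTransition I c d y) (fderiv ℝ (chartTransition I c d) y v) := by
  have hm : chartTransition I c d y ∈ overlap I d e :=
    ⟨(chartTransition_mem_overlap hy).1, by
      rw [mem_preimage, symm_chartTransition hy]; exact hy'.2⟩
  have h1 := (differentiableAt_chartTransition hm).hasFDerivAt.comp y
    (differentiableAt_chartTransition hy).hasFDerivAt
  have h2 : chartTransition I c e =ᶠ[𝓝 y] chartTransition I d e ∘ chartTransition I c d := by
    filter_upwards [(isOpen_overlap c d).mem_nhds hy] with z hz
    simp only [Function.comp_apply, chartTransition, (extChartAt I d).left_inv hz.2]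
  rw [h2.fderiv_eq, h1.fderiv]
  rfl

end ChartTransition

/-! ### The metric in charts -/

section ChartMetric

variable {E : Type*} [NormedAddCommGroup E] [NormedSpace ℝ E]
  {H : Type*} [TopologicalSpace H] {I : ModelWithCorners ℝ E H}
  {M : Type*} [TopologicalSpace M] [ChartedSpace H M]

theorem chartMetric_symm (g : RiemannianMetric (fun x : M => TangentSpace I x)) (c : M) (y : E)
    (v w : E) : chartMetric g c y v w = chartMetric g c y w v :=
  g.symm ((extChartAt I c).symm y) (mfderiv 𝓘(ℝ, E) I (extChartAt I c).symm y v)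
    (mfderiv 𝓘(ℝ, E) I (extChartAt I c).symm y w)

variable [I.Boundaryless] [IsManifold I ∞ M]

theorem chartMetric_apply (g : RiemannianMetric (fun x : M => TangentSpace I x)) {c : M} {y : E}
    (hy : y ∈ (extChartAt I c).target) (v w : E) :
    chartMetric g c y v w = g.inner ((extChartAt I c).symm y)
      (fderiv ℝ (chartTransition I c ((extChartAt I c).symm y)) y v)
      (fderiv ℝ (chartTransition I c ((extChartAt I c).symm y)) y w) := by
  rw [← mfderiv_extChartAt_symm hy]
  rfl

theorem chartMetric_pos (g : RiemannianMetric (fun x : M => TangentSpace I x)) {c : M} {y : E}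
    (hy : y ∈ (extChartAt I c).target) (v : E) (hv : v ≠ 0) : 0 < chartMetric g c y v v := by
  rw [chartMetric_apply g hy]
  refine g.pos _ _ fun h => hv ?_
  have h1 := fderiv_chartTransition_comp (mem_overlap_point hy) v
  rw [show fderiv ℝ (chartTransition I c ((extChartAt I c).symm y)) y v = 0 from h, map_zero] at h1
  exact h1.symm

theorem chartMetric_self (g : RiemannianMetric (fun x : M => TangentSpace I x)) (c : M)
    (v w : E) : chartMetric g c (extChartAt I c c) v w = g.inner c v w := by
  have h : ∀ q (_ : q = c), g.inner q
      (fderiv ℝ (chartTransition I c q) (extChartAt I c c) v)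
      (fderiv ℝ (chartTransition I c q) (extChartAt I c c) w) = g.inner c v w := by
    rintro q rfl
    rw [fderiv_chartTransition_self (mem_extChartAt_target q),
      fderiv_chartTransition_self (mem_extChartAt_target q)]
  exact (chartMetric_apply g (mem_extChartAt_target c) v w).trans
    (h _ ((extChartAt I c).left_inv (mem_extChartAt_source c)))

theorem chartMetric_chartTransition (g : RiemannianMetric (fun x : M => TangentSpace I x))
    {c d : M} {y : E} (hy : y ∈ overlap I c d) (v w : E) :
    chartMetric g c y v w = chartMetric g d (chartTransition I c d y)
      (fderiv ℝ (chartTransition I c d) y v) (fderiv ℝ (chartTransition I c d) y w) := by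
  rw [chartMetric_apply g hy.1, chartMetric_apply g (chartTransition_mem_overlap hy).1,
    symm_chartTransition hy, fderiv_chartTransition_trans hy (mem_overlap_point hy.1),
    fderiv_chartTransition_trans hy (mem_overlap_point hy.1)]

variable [FiniteDimensional ℝ E]

theorem contDiffOn_chartMetric (g : ContMDiffRiemannianMetric I ∞ E
    (fun x : M => TangentSpace I x)) (c : M) :
    ContDiffOn ℝ ∞ (chartMetric g.toRiemannianMetric c) (extChartAt I c).target := by
  rw [contDiffOn_clm_apply]
  intro v
  rw [contDiffOn_clm_apply]
  intro w
  have hs : ∀ v : E, ContMDiffOn 𝓘(ℝ, E) I.tangent ∞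
      (fun y => TotalSpace.mk' E ((extChartAt I c).symm y)
        (mfderiv 𝓘(ℝ, E) I (extChartAt I c).symm y v)) (extChartAt I c).target := by
    intro v
    have h0 := (trivializationAt E (TangentSpace I : M → Type _) c).contMDiffOn_symm
      (n := ∞) (IB := I)
    have h1 := h0.comp ((contMDiffOn_extChartAt_symm (n := ∞) c).prodMk
      (contMDiffOn_const (c := v))) (fun y hy => by simpa using (extChartAt I c).map_target hy)
    refine h1.congr fun y hy => ?_
    have hq : (extChartAt I c).symm y ∈ (chartAt H c).source := by
      simpa using (extChartAt I c).map_target hy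
    have h2 := TangentBundle.symmL_trivializationAt (I := I) hq
    rw [(extChartAt I c).right_inv hy, I.range_eq_univ, mfderivWithin_univ] at h2
    rw [← h2]
    refine Eq.trans (congrArg _ (Trivialization.symmL_apply _ hq v)) ?_
    exact (trivializationAt E (TangentSpace I : M → Type _) c).mk_symm hq v
  have h := ContMDiffOn.clm_bundle_apply₂ (F₁ := E) (F₂ := E) (F₃ := ℝ)
    (E₃ := Bundle.Trivial M ℝ)
    (g.contMDiff.comp_contMDiffOn (contMDiffOn_extChartAt_symm (n := ∞) c)) (hs v) (hs w)
  refine ContMDiffOn.contDiffOn fun y hy => ?_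
  have h3 := h y hy
  simp only [contMDiffWithinAt_totalSpace] at h3
  exact h3.2

end ChartMetric

/-! ### Christoffel symbols -/

section Christoffel

variable {E : Type*} [NormedAddCommGroup E] [NormedSpace ℝ E]

theorem fderiv_apply_apply {V : Type*} [NormedAddCommGroup V] [NormedSpace ℝ V]
    {F : Type*} [NormedAddCommGroup F] [NormedSpace ℝ F]
    {G : V → E →L[ℝ] E →L[ℝ] F} {y : V} (hG : DifferentiableAt ℝ G y) (v : V) (a b : E) :
    fderiv ℝ (fun z => G z a b) y v = fderiv ℝ G y v a b := by
  have h := (hG.hasFDerivAt.clm_apply (hasFDerivAt_const a y)).clm_apply (hasFDerivAt_const b y)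
  rw [h.fderiv]
  simp

variable {H : Type*} [TopologicalSpace H] {I : ModelWithCorners ℝ E H} [I.Boundaryless]
  {M : Type*} [TopologicalSpace M] [ChartedSpace H M] [IsManifold I ∞ M]

theorem chartMetric_ext (g : RiemannianMetric (fun x : M => TangentSpace I x)) {c : M} {y : E}
    (hy : y ∈ (extChartAt I c).target) {a b : E}
    (h : ∀ z, chartMetric g c y a z = chartMetric g c y b z) : a = b := by
  by_contra hab
  have h1 := chartMetric_pos g hy (a - b) (sub_ne_zero.2 hab)
  rw [chartMetric_symm, map_sub, ← chartMetric_symm g c y a, ← chartMetric_symm g c y b] at h1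
  rw [h, sub_self] at h1
  exact h1.false

variable [FiniteDimensional ℝ E]

section

variable (g : ContMDiffRiemannianMetric I ∞ E (fun x : M => TangentSpace I x)) {c d : M} {y : E}

theorem contDiffAt_chartMetric (hy : y ∈ (extChartAt I c).target) :
    ContDiffAt ℝ ∞ (chartMetric g.toRiemannianMetric c) y :=
  (contDiffOn_chartMetric g c).contDiffAt ((isOpen_extChartAt_target c).mem_nhds hy)

theorem differentiableAt_chartMetric (hy : y ∈ (extChartAt I c).target) :
    DifferentiableAt ℝ (chartMetric g.toRiemannianMetric c) y :=
  (contDiffAt_chartMetric g hy).differentiableAt (by simp)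

theorem fderiv_chartMetric_symm (hy : y ∈ (extChartAt I c).target) (v a b : E) :
    fderiv ℝ (chartMetric g.toRiemannianMetric c) y v a b =
      fderiv ℝ (chartMetric g.toRiemannianMetric c) y v b a := by
  rw [← fderiv_apply_apply (differentiableAt_chartMetric g hy),
    ← fderiv_apply_apply (differentiableAt_chartMetric g hy)]
  simp_rw [chartMetric_symm g.toRiemannianMetric c _ a b]

theorem chartMetric_christoffel_apply (hy : y ∈ (extChartAt I c).target) (v w z : E) :
    chartMetric g.toRiemannianMetric c y (christoffel g.toRiemannianMetric c y v w) z =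
      1 / 2 * (fderiv ℝ (chartMetric g.toRiemannianMetric c) y v w z +
        fderiv ℝ (chartMetric g.toRiemannianMetric c) y w v z -
        fderiv ℝ (chartMetric g.toRiemannianMetric c) y z v w) :=
  chartMetric_christoffel _ _ _ _ _ _ (chartMetric_pos _ hy)

/-- The Levi-Civita connection has no torsion. -/
theorem christoffel_symm (hy : y ∈ (extChartAt I c).target) (v w : E) :
    christoffel g.toRiemannianMetric c y v w = christoffel g.toRiemannianMetric c y w v := by
  refine chartMetric_ext g.toRiemannianMetric hy fun z => ?_
  rw [chartMetric_christoffel_apply g hy, chartMetric_christoffel_apply g hy,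
    fderiv_chartMetric_symm g hy z v w]
  ring

/-- The Levi-Civita connection is compatible with the metric. -/
theorem fderiv_chartMetric (hy : y ∈ (extChartAt I c).target) (v a b : E) :
    fderiv ℝ (chartMetric g.toRiemannianMetric c) y v a b =
      chartMetric g.toRiemannianMetric c y (christoffel g.toRiemannianMetric c y v a) b +
      chartMetric g.toRiemannianMetric c y a (christoffel g.toRiemannianMetric c y v b) := by
  rw [chartMetric_symm _ _ _ a, chartMetric_christoffel_apply g hy,
    chartMetric_christoffel_apply g hy, fderiv_chartMetric_symm g hy v b a]
  ring

set_option maxSynthPendingDepth 3 in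
set_option synthInstance.maxHeartbeats 200000 in
theorem fderiv_chartMetric_chartTransition (hy : y ∈ overlap I c d) (v a b : E) :
    fderiv ℝ (chartMetric g.toRiemannianMetric c) y v a b =
      fderiv ℝ (chartMetric g.toRiemannianMetric d) (chartTransition I c d y)
          (fderiv ℝ (chartTransition I c d) y v) (fderiv ℝ (chartTransition I c d) y a)
          (fderiv ℝ (chartTransition I c d) y b) +
        chartMetric g.toRiemannianMetric d (chartTransition I c d y)
          (fderiv ℝ (fderiv ℝ (chartTransition I c d)) y v a)
          (fderiv ℝ (chartTransition I c d) y b) +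
        chartMetric g.toRiemannianMetric d (chartTransition I c d y)
          (fderiv ℝ (chartTransition I c d) y a)
          (fderiv ℝ (fderiv ℝ (chartTransition I c d)) y v b) := by
  have hG := (differentiableAt_chartMetric g (chartTransition_mem_overlap hy).1).hasFDerivAt
  have hψ := (differentiableAt_chartTransition hy).hasFDerivAt
  have hD := (differentiableAt_fderiv_chartTransition hy).hasFDerivAt
  have hGψ : HasFDerivAt (fun z => chartMetric g.toRiemannianMetric d (chartTransition I c d z)) _ y :=
    hG.comp y hψ
  have h := (hGψ.clm_apply (hD.clm_apply (hasFDerivAt_const a y))).clm_apply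
    (hD.clm_apply (hasFDerivAt_const b y))
  have he : (fun z => chartMetric g.toRiemannianMetric c z a b) =ᶠ[𝓝 y] fun z =>
      chartMetric g.toRiemannianMetric d (chartTransition I c d z)
        (fderiv ℝ (chartTransition I c d) z a) (fderiv ℝ (chartTransition I c d) z b) := by
    filter_upwards [(isOpen_overlap c d).mem_nhds hy] with z hz
    exact chartMetric_chartTransition _ hz a b
  rw [← fderiv_apply_apply (differentiableAt_chartMetric g hy.1), he.fderiv_eq]
  refine (congrArg (fun T : E →L[ℝ] ℝ => T v) h.fderiv).trans ?_
  simp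
  ring

/-- The transformation law of the Christoffel symbols. -/
theorem christoffel_chartTransition (hy : y ∈ overlap I c d) (a b : E) :
    christoffel g.toRiemannianMetric d (chartTransition I c d y)
        (fderiv ℝ (chartTransition I c d) y a) (fderiv ℝ (chartTransition I c d) y b) +
      fderiv ℝ (fderiv ℝ (chartTransition I c d)) y a b =
    fderiv ℝ (chartTransition I c d) y (christoffel g.toRiemannianMetric c y a b) := by
  have hd := (chartTransition_mem_overlap hy).1
  refine chartMetric_ext g.toRiemannianMetric hd fun z' => ?_
  obtain ⟨z, rfl⟩ : ∃ z, fderiv ℝ (chartTransition I c d) y z = z' :=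
    ⟨_, fderiv_chartTransition_comp' hy z'⟩
  rw [← chartMetric_chartTransition _ hy, map_add, add_apply, chartMetric_christoffel_apply g hd,
    chartMetric_christoffel_apply g hy.1, fderiv_chartMetric_chartTransition g hy,
    fderiv_chartMetric_chartTransition g hy, fderiv_chartMetric_chartTransition g hy,
    fderiv_chartTransition_symm hy b a, fderiv_chartTransition_symm hy z a,
    fderiv_chartTransition_symm hy z b,
    chartMetric_symm _ _ _ (fderiv ℝ (fderiv ℝ (chartTransition I c d)) y a z)]
  ring

theorem contDiffAt_inverse_chartMetric (hy : y ∈ (extChartAt I c).target) :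
    ContDiffAt ℝ ∞ (fun z => (chartMetric g.toRiemannianMetric c z).inverse) y := by
  have := FiniteDimensional.complete ℝ E
  exact (isInvertible_of_pos (chartMetric_pos _ hy)).contDiffAt_map_inverse.comp y
    (contDiffAt_chartMetric g hy)

set_option maxSynthPendingDepth 3 in
set_option synthInstance.maxHeartbeats 200000 in
theorem contDiffOn_christoffel (c : M) :
    ContDiffOn ℝ ∞ (christoffel g.toRiemannianMetric c) (extChartAt I c).target := by
  have hD : ContDiffOn ℝ ∞ (fderiv ℝ (chartMetric g.toRiemannianMetric c))
      (extChartAt I c).target :=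
    (contDiffOn_chartMetric g c).fderiv_of_isOpen (m := ∞) (isOpen_extChartAt_target c)
      (by norm_cast)
  have hS : ContDiffOn ℝ ∞ (fun z => (chartMetric g.toRiemannianMetric c z).inverse)
      (extChartAt I c).target :=
    fun z hz => (contDiffAt_inverse_chartMetric g hz).contDiffWithinAt
  rw [contDiffOn_clm_apply]
  intro v
  rw [contDiffOn_clm_apply]
  intro w
  simp_rw [christoffel_apply]
  have h3 : ContDiffOn ℝ ∞ (fun z =>
      ((fderiv ℝ (chartMetric g.toRiemannianMetric c) z).flip v).flip w)
      (extChartAt I c).target := by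
    rw [contDiffOn_clm_apply]
    intro u
    exact ((hD.clm_apply contDiffOn_const).clm_apply contDiffOn_const).clm_apply contDiffOn_const
  exact contDiffOn_const.smul (((hS.clm_apply ((hD.clm_apply contDiffOn_const).clm_apply
    contDiffOn_const)).add (hS.clm_apply ((hD.clm_apply contDiffOn_const).clm_apply
    contDiffOn_const))).sub (hS.clm_apply h3))

theorem differentiableAt_christoffel (hy : y ∈ (extChartAt I c).target) :
    DifferentiableAt ℝ (christoffel g.toRiemannianMetric c) y :=
  ((contDiffOn_christoffel g c).contDiffAt
    ((isOpen_extChartAt_target c).mem_nhds hy)).differentiableAt (by simp)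

end

end Christoffel

/-! ### Charts of the tangent bundle -/

section TangentBundleCharts

variable {E : Type*} [NormedAddCommGroup E] [NormedSpace ℝ E]
  {H : Type*} [TopologicalSpace H] {I : ModelWithCorners ℝ E H} [I.Boundaryless]
  {M : Type*} [TopologicalSpace M] [ChartedSpace H M] [IsManifold I ∞ M]

theorem extChartAt_tangent_apply (p z : TangentBundle I M) :
    extChartAt I.tangent p z = (extChartAt I p.proj z.proj,
      fderiv ℝ (chartTransition I z.proj p.proj) (extChartAt I z.proj z.proj) z.snd) := by
  rw [← fderivWithin_univ, ← I.range_eq_univ]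
  rfl

omit [I.Boundaryless] in
theorem mem_extChartAt_tangent_source (p z : TangentBundle I M) :
    z ∈ (extChartAt I.tangent p).source ↔ z.proj ∈ (extChartAt I p.proj).source := by
  simp only [extChartAt_source, TangentBundle.mem_chart_source_iff]

omit [I.Boundaryless] in
theorem mem_extChartAt_tangent_target (p : TangentBundle I M) (y w : E) :
    (y, w) ∈ (extChartAt I.tangent p).target ↔ y ∈ (extChartAt I p.proj).target := by
  rw [FiberBundle.extChartAt_target]
  simp only [mem_inter_iff, mem_prod, mem_preimage, mem_univ, and_true,
    TangentBundle.trivializationAt_baseSet, extChartAt_target]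
  refine ⟨fun h => h.1, fun h => ⟨h, ?_⟩⟩
  rw [← extChartAt_source I]
  exact (extChartAt I p.proj).map_target (by rwa [extChartAt_target])

theorem extChartAt_tangent_symm (p : TangentBundle I M) {y : E} (w : E)
    (hy : y ∈ (extChartAt I p.proj).target) :
    (extChartAt I.tangent p).symm (y, w) = ⟨(extChartAt I p.proj).symm y,
      fderiv ℝ (chartTransition I p.proj ((extChartAt I p.proj).symm y)) y w⟩ := by
  set z : TangentBundle I M := ⟨(extChartAt I p.proj).symm y,
      fderiv ℝ (chartTransition I p.proj ((extChartAt I p.proj).symm y)) y w⟩ with hz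
  have hs : z ∈ (extChartAt I.tangent p).source :=
    (mem_extChartAt_tangent_source p z).2 ((extChartAt I p.proj).map_target hy)
  have h : extChartAt I.tangent p z = (y, w) := by
    rw [extChartAt_tangent_apply]
    exact Prod.ext ((extChartAt I p.proj).right_inv hy)
      (fderiv_chartTransition_comp (mem_overlap_point hy) w)
  rw [← h, (extChartAt I.tangent p).left_inv hs]

theorem chartTransition_tangent {p q : TangentBundle I M} {y : E} (w : E)
    (hy : y ∈ overlap I p.proj q.proj) :
    chartTransition I.tangent p q (y, w) = (chartTransition I p.proj q.proj y,
      fderiv ℝ (chartTransition I p.proj q.proj) y w) := by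
  rw [chartTransition, extChartAt_tangent_symm p w hy.1, extChartAt_tangent_apply]
  refine Prod.ext rfl ?_
  exact (fderiv_chartTransition_trans (mem_overlap_point hy.1) hy w).symm

theorem fderiv_chartTransition_tangent {p q : TangentBundle I M} {y : E} (w : E)
    (hy : y ∈ overlap I p.proj q.proj) (a b : E) :
    fderiv ℝ (chartTransition I.tangent p q) (y, w) (a, b) =
      (fderiv ℝ (chartTransition I p.proj q.proj) y a,
        fderiv ℝ (fderiv ℝ (chartTransition I p.proj q.proj)) y a w +
          fderiv ℝ (chartTransition I p.proj q.proj) y b) := by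
  have he : chartTransition I.tangent p q =ᶠ[𝓝 (y, w)] fun z : E × E =>
      (chartTransition I p.proj q.proj z.1,
        fderiv ℝ (chartTransition I p.proj q.proj) z.1 z.2) := by
    filter_upwards [continuous_fst.continuousAt.preimage_mem_nhds
      ((isOpen_overlap p.proj q.proj).mem_nhds hy)] with z hz
    exact chartTransition_tangent z.2 hz
  have h1 : HasFDerivAt (fun z : E × E => chartTransition I p.proj q.proj z.1) _ (y, w) :=
    HasFDerivAt.comp (g := chartTransition I p.proj q.proj) (y, w)
      (differentiableAt_chartTransition hy).hasFDerivAt hasFDerivAt_fst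
  have h2 : HasFDerivAt (fun z : E × E => fderiv ℝ (chartTransition I p.proj q.proj) z.1) _
      (y, w) :=
    HasFDerivAt.comp (g := fderiv ℝ (chartTransition I p.proj q.proj)) (y, w)
      (differentiableAt_fderiv_chartTransition hy).hasFDerivAt hasFDerivAt_fst
  have h3 := h1.prodMk (h2.clm_apply hasFDerivAt_snd)
  rw [he.fderiv_eq]
  refine (congrArg (fun T : E × E →L[ℝ] E × E => T (a, b)) h3.fderiv).trans ?_
  simp [add_comm]

end TangentBundleCharts

section Function

variable {E : Type*} [NormedAddCommGroup E] [NormedSpace ℝ E]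
  {H : Type*} [TopologicalSpace H] {I : ModelWithCorners ℝ E H} [I.Boundaryless]
  {M : Type*} [TopologicalSpace M] [ChartedSpace H M]

variable (I) in
/-- The coordinate expression of a function in the chart at `c`. -/
def chartFun (f : M → ℝ) (c : M) (y : E) : ℝ := f ((extChartAt I c).symm y)

theorem mfderiv_eq_fderiv_chartFun {f : M → ℝ} {x : M} (hf : MDifferentiableAt I 𝓘(ℝ, ℝ) f x) :
    (mfderiv I 𝓘(ℝ, ℝ) f x : E →L[ℝ] ℝ) = fderiv ℝ (chartFun I f x) (extChartAt I x x) := by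
  refine hf.mfderiv.trans ?_
  rw [I.range_eq_univ, fderivWithin_univ]
  rfl

variable [IsManifold I ∞ M] {f : M → ℝ}

omit [I.Boundaryless] in
theorem contDiffOn_chartFun (hf : ContMDiff I 𝓘(ℝ, ℝ) ∞ f) (c : M) :
    ContDiffOn ℝ ∞ (chartFun I f c) (extChartAt I c).target :=
  (hf.comp_contMDiffOn (contMDiffOn_extChartAt_symm c)).contDiffOn

theorem contDiffAt_chartFun (hf : ContMDiff I 𝓘(ℝ, ℝ) ∞ f) {c : M} {y : E}
    (hy : y ∈ (extChartAt I c).target) : ContDiffAt ℝ ∞ (chartFun I f c) y :=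
  (contDiffOn_chartFun hf c).contDiffAt ((isOpen_extChartAt_target c).mem_nhds hy)

theorem differentiableAt_chartFun (hf : ContMDiff I 𝓘(ℝ, ℝ) ∞ f) {c : M} {y : E}
    (hy : y ∈ (extChartAt I c).target) : DifferentiableAt ℝ (chartFun I f c) y :=
  (contDiffAt_chartFun hf hy).differentiableAt (by simp)

theorem differentiableAt_fderiv_chartFun (hf : ContMDiff I 𝓘(ℝ, ℝ) ∞ f) {c : M} {y : E}
    (hy : y ∈ (extChartAt I c).target) : DifferentiableAt ℝ (fderiv ℝ (chartFun I f c)) y :=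
  ((contDiffAt_chartFun hf hy).fderiv_right (m := 1) (by norm_cast)).differentiableAt (by simp)

theorem fderiv_chartFun_symm (hf : ContMDiff I 𝓘(ℝ, ℝ) ∞ f) {c : M} {y : E}
    (hy : y ∈ (extChartAt I c).target) (v w : E) :
    fderiv ℝ (fderiv ℝ (chartFun I f c)) y v w = fderiv ℝ (fderiv ℝ (chartFun I f c)) y w v :=
  ((contDiffAt_chartFun hf hy).isSymmSndFDerivAt
    (by simp only [minSmoothness_of_isRCLikeNormedField]; norm_cast)) v w

theorem dirDeriv_chartTransition (hf : ContMDiff I 𝓘(ℝ, ℝ) ∞ f) {c : M} {y : E}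
    (hy : y ∈ (extChartAt I c).target) (v : E) :
    dirDeriv (I := I) f ((extChartAt I c).symm y)
      (fderiv ℝ (chartTransition I c ((extChartAt I c).symm y)) y v) =
      fderiv ℝ (chartFun I f c) y v := by
  have ho := mem_overlap_point hy
  have hF := (differentiableAt_chartFun hf (chartTransition_mem_overlap ho).1).hasFDerivAt
  have h := hF.comp y (differentiableAt_chartTransition ho).hasFDerivAt
  have he : chartFun I f c =ᶠ[𝓝 y] chartFun I f ((extChartAt I c).symm y) ∘
      chartTransition I c ((extChartAt I c).symm y) := by
    filter_upwards [(isOpen_overlap c ((extChartAt I c).symm y)).mem_nhds ho] with z hz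
    simp only [chartFun, Function.comp_apply, symm_chartTransition hz]
  rw [he.fderiv_eq, h.fderiv]
  exact congrArg (fun T : E →L[ℝ] ℝ => T _)
    (mfderiv_eq_fderiv_chartFun
      ((hf ((extChartAt I c).symm y)).mdifferentiableAt (by simp)))

end Function

section MusGradient

variable {E : Type*} [NormedAddCommGroup E] [NormedSpace ℝ E]
  {H : Type*} [TopologicalSpace H] {I : ModelWithCorners ℝ E H} [I.Boundaryless]
  {M : Type*} [TopologicalSpace M] [ChartedSpace H M] [IsManifold I ∞ M]
  [FiniteDimensional ℝ E]

omit [I.Boundaryless] [FiniteDimensional ℝ E] in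
theorem musGradientForm_mk (g : RiemannianMetric (fun x : M => TangentSpace I x)) (f : M → ℝ)
    {q : TangentBundle I M} {x : M} {u : E} (hq : q = ⟨x, u⟩) (a b a' b' : E) :
    (musGradientForm g f q : E × E →L[ℝ] E × E →L[ℝ] ℝ) (a, b) (a', b') =
      g.inner x a a' +
      (g.inner x (b + christoffelAt g x a u : E) (b' + christoffelAt g x a' u : E) +
      dirDeriv (I := I) f x (b + christoffelAt g x a u : E) *
      dirDeriv (I := I) f x (b' + christoffelAt g x a' u : E)) := by
  subst hq
  exact musGradientForm_apply g f ⟨x, u⟩ (a, b) (a', b')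

omit [FiniteDimensional ℝ E] in
theorem fderiv_chartTransition_tangent_of_eq {p q : TangentBundle I M} {x : M} {u : E}
    (hq : q = ⟨x, u⟩) {y : E} (w : E) (hy : y ∈ overlap I p.proj x) (a b : E) :
    fderiv ℝ (chartTransition I.tangent p q) (y, w) (a, b) =
      (fderiv ℝ (chartTransition I p.proj x) y a,
        fderiv ℝ (fderiv ℝ (chartTransition I p.proj x)) y a w +
          fderiv ℝ (chartTransition I p.proj x) y b) := by
  obtain rfl : x = q.proj := by rw [hq]
  rw [fderiv_chartTransition_tangent w hy]

/-- The Mus-Gradient metric in the coordinates of the tangent bundle induced by the chart at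
`p.proj`. -/
theorem chartMetric_musGradientMetric
    (g : ContMDiffRiemannianMetric I ∞ E (fun x : M => TangentSpace I x)) {f : M → ℝ}
    (hf : ContMDiff I 𝓘(ℝ, ℝ) ∞ f) (p : TangentBundle I M) {y : E} (w : E)
    (hy : y ∈ (extChartAt I p.proj).target) (a b a' b' : E) :
    chartMetric (musGradientMetric g.toRiemannianMetric f) p (y, w) (a, b) (a', b') =
      chartMetric g.toRiemannianMetric p.proj y a a' +
      (chartMetric g.toRiemannianMetric p.proj y
        (b + christoffel g.toRiemannianMetric p.proj y a w)
        (b' + christoffel g.toRiemannianMetric p.proj y a' w) +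
      fderiv ℝ (chartFun I f p.proj) y (b + christoffel g.toRiemannianMetric p.proj y a w) *
      fderiv ℝ (chartFun I f p.proj) y
        (b' + christoffel g.toRiemannianMetric p.proj y a' w)) := by
  have ho := mem_overlap_point hy
  have hK : ∀ a b : E, fderiv ℝ (fderiv ℝ
        (chartTransition I p.proj ((extChartAt I p.proj).symm y))) y a w +
      fderiv ℝ (chartTransition I p.proj ((extChartAt I p.proj).symm y)) y b +
      christoffelAt g.toRiemannianMetric ((extChartAt I p.proj).symm y)
        (fderiv ℝ (chartTransition I p.proj ((extChartAt I p.proj).symm y)) y a)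
        (fderiv ℝ (chartTransition I p.proj ((extChartAt I p.proj).symm y)) y w) =
      fderiv ℝ (chartTransition I p.proj ((extChartAt I p.proj).symm y)) y
        (b + christoffel g.toRiemannianMetric p.proj y a w) := by
    intro a b
    rw [map_add, ← christoffel_chartTransition g ho]
    change _ + _ + christoffel _ _ (chartTransition I _ _ _) _ _ = _
    abel
  have hq := extChartAt_tangent_symm p w hy
  refine (chartMetric_apply _ ((mem_extChartAt_tangent_target p y w).2 hy) _ _).trans ?_
  rw [fderiv_chartTransition_tangent_of_eq hq w ho, fderiv_chartTransition_tangent_of_eq hq w ho]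
  refine (musGradientForm_mk g.toRiemannianMetric f hq _ _ _ _).trans ?_
  rw [hK, hK, dirDeriv_chartTransition hf hy, dirDeriv_chartTransition hf hy,
    chartMetric_apply _ hy, chartMetric_apply _ hy]

end MusGradient

/-! ### The Christoffel symbols of the Mus-Gradient metric -/

section MusGradientChristoffel

variable {E : Type*} [NormedAddCommGroup E] [NormedSpace ℝ E]
  {H : Type*} [TopologicalSpace H] {I : ModelWithCorners ℝ E H}
  {M : Type*} [TopologicalSpace M] [ChartedSpace H M]

/-- The Hessian `∂ᵢ∂ⱼf - Γᵏᵢⱼ ∂ₖf` of a function in the chart at `c`. -/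
def chartHessian (g : RiemannianMetric (fun x : M => TangentSpace I x)) (f : M → ℝ) (c : M)
    (y v w : E) : ℝ :=
  fderiv ℝ (fderiv ℝ (chartFun I f c)) y v w - fderiv ℝ (chartFun I f c) y (christoffel g c y v w)

variable [I.Boundaryless] [IsManifold I ∞ M] [FiniteDimensional ℝ E]
  (g : ContMDiffRiemannianMetric I ∞ E (fun x : M => TangentSpace I x)) {f : M → ℝ}
  (hf : ContMDiff I 𝓘(ℝ, ℝ) ∞ f)

include hf

theorem chartHessian_symm {c : M} {y : E} (hy : y ∈ (extChartAt I c).target) (v w : E) :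
    chartHessian g.toRiemannianMetric f c y v w = chartHessian g.toRiemannianMetric f c y w v := by
  unfold chartHessian
  rw [fderiv_chartFun_symm hf hy, christoffel_symm g hy]

theorem contDiffOn_chartMetric_musGradientMetric (p : TangentBundle I M) :
    ContDiffOn ℝ ∞ (chartMetric (musGradientMetric g.toRiemannianMetric f) p)
      (extChartAt I.tangent p).target := by
  have hm : MapsTo (Prod.fst : E × E → E) (extChartAt I.tangent p).target
      (extChartAt I p.proj).target :=
    fun z hz => (mem_extChartAt_tangent_target p z.1 z.2).1 hz
  have hG := (contDiffOn_chartMetric g p.proj).comp contDiffOn_fst hm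
  have hΓ := (contDiffOn_christoffel g p.proj).comp contDiffOn_fst hm
  have hF : ContDiffOn ℝ ∞ (fderiv ℝ (chartFun I f p.proj)) (extChartAt I p.proj).target :=
    (contDiffOn_chartFun hf p.proj).fderiv_of_isOpen (m := ∞) (isOpen_extChartAt_target p.proj)
      (by norm_cast)
  have hF := hF.comp contDiffOn_fst hm
  have hK : ∀ ξ : E × E, ContDiffOn ℝ ∞
      (fun z : E × E => ξ.2 + christoffel g.toRiemannianMetric p.proj z.1 ξ.1 z.2)
      (extChartAt I.tangent p).target := fun ξ =>
    contDiffOn_const.add ((hΓ.clm_apply contDiffOn_const).clm_apply contDiffOn_snd)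
  rw [contDiffOn_clm_apply]
  intro ξ
  rw [contDiffOn_clm_apply]
  intro η
  have h := ((hG.clm_apply (contDiffOn_const (c := ξ.1))).clm_apply
    (contDiffOn_const (c := η.1))).add (((hG.clm_apply (hK ξ)).clm_apply (hK η)).add
    ((hF.clm_apply (hK ξ)).mul (hF.clm_apply (hK η))))
  exact h.congr fun z hz => chartMetric_musGradientMetric g hf p z.2 (hm hz) ξ.1 ξ.2 η.1 η.2

theorem differentiableAt_chartMetric_musGradientMetric (p : TangentBundle I M) {y : E} (w : E)
    (hy : y ∈ (extChartAt I p.proj).target) :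
    DifferentiableAt ℝ (chartMetric (musGradientMetric g.toRiemannianMetric f) p) (y, w) :=
  ((contDiffOn_chartMetric_musGradientMetric g hf p).contDiffAt
    ((isOpen_extChartAt_target p).mem_nhds
      ((mem_extChartAt_tangent_target p y w).2 hy))).differentiableAt (by simp)

set_option maxSynthPendingDepth 3 in
set_option synthInstance.maxHeartbeats 200000 in
theorem fderiv_chartMetric_musGradientMetric (p : TangentBundle I M) {y : E} (w : E)
    (hy : y ∈ (extChartAt I p.proj).target) (ζ ξ η : E × E) {k l k' l' : E}
    (hk : ξ.2 + christoffel g.toRiemannianMetric p.proj y ξ.1 w = k)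
    (hl : η.2 + christoffel g.toRiemannianMetric p.proj y η.1 w = l)
    (hk' : fderiv ℝ (christoffel g.toRiemannianMetric p.proj) y ζ.1 ξ.1 w +
      christoffel g.toRiemannianMetric p.proj y ξ.1 ζ.2 = k')
    (hl' : fderiv ℝ (christoffel g.toRiemannianMetric p.proj) y ζ.1 η.1 w +
      christoffel g.toRiemannianMetric p.proj y η.1 ζ.2 = l') :
    fderiv ℝ (chartMetric (musGradientMetric g.toRiemannianMetric f) p) (y, w) ζ ξ η =
      fderiv ℝ (chartMetric g.toRiemannianMetric p.proj) y ζ.1 ξ.1 η.1 +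
      (fderiv ℝ (chartMetric g.toRiemannianMetric p.proj) y ζ.1 k l +
        chartMetric g.toRiemannianMetric p.proj y k' l +
        chartMetric g.toRiemannianMetric p.proj y k l') +
      ((fderiv ℝ (fderiv ℝ (chartFun I f p.proj)) y ζ.1 k +
          fderiv ℝ (chartFun I f p.proj) y k') * fderiv ℝ (chartFun I f p.proj) y l +
        fderiv ℝ (chartFun I f p.proj) y k * (fderiv ℝ (fderiv ℝ (chartFun I f p.proj)) y ζ.1 l +
          fderiv ℝ (chartFun I f p.proj) y l')) := by
  have hG : HasFDerivAt (fun z : E × E => chartMetric g.toRiemannianMetric p.proj z.1) _ (y, w) :=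
    HasFDerivAt.comp (g := chartMetric g.toRiemannianMetric p.proj) (y, w)
      (differentiableAt_chartMetric g hy).hasFDerivAt hasFDerivAt_fst
  have hΓ : HasFDerivAt (fun z : E × E => christoffel g.toRiemannianMetric p.proj z.1) _ (y, w) :=
    HasFDerivAt.comp (g := christoffel g.toRiemannianMetric p.proj) (y, w)
      (differentiableAt_christoffel g hy).hasFDerivAt hasFDerivAt_fst
  have hF : HasFDerivAt (fun z : E × E => fderiv ℝ (chartFun I f p.proj) z.1) _ (y, w) :=
    HasFDerivAt.comp (g := fderiv ℝ (chartFun I f p.proj)) (y, w)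
      (differentiableAt_fderiv_chartFun hf hy).hasFDerivAt hasFDerivAt_fst
  have hK := fun ξ : E × E => ((hΓ.clm_apply (hasFDerivAt_const ξ.1 (y, w))).clm_apply
    hasFDerivAt_snd).const_add ξ.2
  have h := ((hG.clm_apply (hasFDerivAt_const ξ.1 (y, w))).clm_apply
    (hasFDerivAt_const η.1 (y, w))).add (((hG.clm_apply (hK ξ)).clm_apply (hK η)).add
    ((hF.clm_apply (hK ξ)).mul (hF.clm_apply (hK η))))
  have he : (fun z => chartMetric (musGradientMetric g.toRiemannianMetric f) p z ξ η) =ᶠ[𝓝 (y, w)]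
      fun z => chartMetric g.toRiemannianMetric p.proj z.1 ξ.1 η.1 +
      (chartMetric g.toRiemannianMetric p.proj z.1
        (ξ.2 + christoffel g.toRiemannianMetric p.proj z.1 ξ.1 z.2)
        (η.2 + christoffel g.toRiemannianMetric p.proj z.1 η.1 z.2) +
      fderiv ℝ (chartFun I f p.proj) z.1
        (ξ.2 + christoffel g.toRiemannianMetric p.proj z.1 ξ.1 z.2) *
      fderiv ℝ (chartFun I f p.proj) z.1
        (η.2 + christoffel g.toRiemannianMetric p.proj z.1 η.1 z.2)) := by
    filter_upwards [continuous_fst.continuousAt.preimage_mem_nhds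
      ((isOpen_extChartAt_target p.proj).mem_nhds hy)] with z hz
    exact chartMetric_musGradientMetric g hf p z.2 hz ξ.1 ξ.2 η.1 η.2
  rw [← fderiv_apply_apply (differentiableAt_chartMetric_musGradientMetric g hf p w hy),
    he.fderiv_eq]
  refine (congrArg (fun T : E × E →L[ℝ] ℝ => T ζ) h.fderiv).trans ?_
  simp [hk, hl]
  rw [← hk', ← hl']
  simp only [map_add, add_apply]
  ring

theorem chartMetric_musGradientMetric_horizontal (p : TangentBundle I M) {y : E} (w : E)
    (hy : y ∈ (extChartAt I p.proj).target) (ξ : E × E) (v : E) :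
    chartMetric (musGradientMetric g.toRiemannianMetric f) p (y, w) ξ
        (v, -christoffel g.toRiemannianMetric p.proj y v w) =
      chartMetric g.toRiemannianMetric p.proj y ξ.1 v := by
  refine (chartMetric_musGradientMetric g hf p w hy ξ.1 ξ.2 v _).trans ?_
  simp

theorem chartMetric_christoffel_musGradientMetric (p : TangentBundle I M) {y : E} (w : E)
    (hy : y ∈ (extChartAt I p.proj).target) (ξ : E × E) (v : E) :
    chartMetric g.toRiemannianMetric p.proj y
        (christoffel (musGradientMetric g.toRiemannianMetric f) p (y, w) ξ ξ).1 v =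
      fderiv ℝ (chartMetric (musGradientMetric g.toRiemannianMetric f) p) (y, w) ξ ξ
          (v, -christoffel g.toRiemannianMetric p.proj y v w) -
        1 / 2 * fderiv ℝ (chartMetric (musGradientMetric g.toRiemannianMetric f) p) (y, w)
          (v, -christoffel g.toRiemannianMetric p.proj y v w) ξ ξ := by
  rw [← chartMetric_musGradientMetric_horizontal g hf p w hy]
  refine (chartMetric_christoffel _ _ _ _ _ _ (chartMetric_pos _
    ((mem_extChartAt_tangent_target p y w).2 hy))).trans ?_
  ring

set_option maxSynthPendingDepth 3 in
set_option synthInstance.maxHeartbeats 200000 in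
theorem christoffel_musGradientMetric_horizontal (p : TangentBundle I M) {y : E} (w : E)
    (hy : y ∈ (extChartAt I p.proj).target) (a : E) :
    (christoffel (musGradientMetric g.toRiemannianMetric f) p (y, w)
        (a, -christoffel g.toRiemannianMetric p.proj y a w)
        (a, -christoffel g.toRiemannianMetric p.proj y a w)).1 =
      christoffel g.toRiemannianMetric p.proj y a a := by
  refine chartMetric_ext g.toRiemannianMetric hy fun v => ?_
  rw [chartMetric_christoffel_musGradientMetric g hf p w hy,
    fderiv_chartMetric_musGradientMetric g hf p w hy _ _ _ (neg_add_cancel _) (neg_add_cancel _)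
      rfl rfl,
    fderiv_chartMetric_musGradientMetric g hf p w hy _ _ _ (neg_add_cancel _) (neg_add_cancel _)
      rfl rfl, chartMetric_christoffel_apply g hy]
  simp only [map_zero, zero_apply]
  ring

set_option maxSynthPendingDepth 3 in
set_option synthInstance.maxHeartbeats 200000 in
theorem christoffel_musGradientMetric_vertical (p : TangentBundle I M) {y : E} (w : E)
    (hy : y ∈ (extChartAt I p.proj).target) (b v : E) :
    chartMetric g.toRiemannianMetric p.proj y
        (christoffel (musGradientMetric g.toRiemannianMetric f) p (y, w) (0, b) (0, b)).1 v =
      -(fderiv ℝ (chartFun I f p.proj) y b *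
        chartHessian g.toRiemannianMetric f p.proj y v b) := by
  have hz : b + christoffel g.toRiemannianMetric p.proj y 0 w = b := by simp
  rw [chartMetric_christoffel_musGradientMetric g hf p w hy,
    fderiv_chartMetric_musGradientMetric g hf p w hy _ _ _ hz (neg_add_cancel _) rfl rfl,
    fderiv_chartMetric_musGradientMetric g hf p w hy _ _ _ hz hz rfl rfl]
  simp only [map_zero, zero_apply, zero_add, add_zero, mul_zero]
  rw [fderiv_chartMetric g hy, chartMetric_symm _ _ _ (christoffel _ _ _ _ _), chartHessian]
  ring

end MusGradientChristoffel

/-! ### The second fundamental form of the projection -/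

section Projection

variable {E : Type*} [NormedAddCommGroup E] [NormedSpace ℝ E]
  {H : Type*} [TopologicalSpace H] {I : ModelWithCorners ℝ E H}
  {M : Type*} [TopologicalSpace M] [ChartedSpace H M]
  [I.Boundaryless] [IsManifold I ∞ M]

theorem extChartAt_tangent_self (p : TangentBundle I M) :
    extChartAt I.tangent p p = ((extChartAt I p.proj p.proj, p.snd) : E × E) := by
  rw [extChartAt_tangent_apply]
  exact Prod.ext rfl (fderiv_chartTransition_self (E := E) (mem_extChartAt_target p.proj) p.snd)

theorem writtenInExtChartAt_proj (p : TangentBundle I M) {y : E} (w : E)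
    (hy : y ∈ (extChartAt I p.proj).target) :
    writtenInExtChartAt I.tangent I p (TotalSpace.proj : TangentBundle I M → M) (y, w) = y := by
  simp only [writtenInExtChartAt, Function.comp_apply, extChartAt_tangent_symm p w hy]
  exact (extChartAt I p.proj).right_inv hy

theorem fderiv_writtenInExtChartAt_proj (p : TangentBundle I M) {y : E} (w : E)
    (hy : y ∈ (extChartAt I p.proj).target) :
    fderiv ℝ (writtenInExtChartAt I.tangent I p (TotalSpace.proj : TangentBundle I M → M)) (y, w) =
      ContinuousLinearMap.fst ℝ E E := by
  have he : writtenInExtChartAt I.tangent I p (TotalSpace.proj : TangentBundle I M → M)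
      =ᶠ[𝓝 (y, w)] Prod.fst := by
    filter_upwards [continuous_fst.continuousAt.preimage_mem_nhds
      ((isOpen_extChartAt_target p.proj).mem_nhds hy)] with z hz
    exact writtenInExtChartAt_proj p z.2 hz
  rw [he.fderiv_eq]
  exact fderiv_fst

theorem secondFundamentalForm_proj
    (h : RiemannianMetric (fun p : TangentBundle I M => TangentSpace I.tangent p))
    (g : RiemannianMetric (fun x : M => TangentSpace I x)) (p : TangentBundle I M) (ξ η : E × E) :
    secondFundamentalForm h g (TotalSpace.proj : TangentBundle I M → M) p ξ η =
      christoffel g p.proj (extChartAt I p.proj p.proj) ξ.1 η.1 -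
        (christoffel h p ((extChartAt I p.proj p.proj, p.snd) : E × E) ξ η).1 := by
  have hy := mem_extChartAt_target (I := I) p.proj
  have he : fderiv ℝ (writtenInExtChartAt I.tangent I p
      (TotalSpace.proj : TangentBundle I M → M))
      =ᶠ[𝓝 ((extChartAt I p.proj p.proj, p.snd) : E × E)] fun _ => ContinuousLinearMap.fst ℝ E E := by
    filter_upwards [continuous_fst.continuousAt.preimage_mem_nhds
      ((isOpen_extChartAt_target p.proj).mem_nhds hy)] with z hz
    exact fderiv_writtenInExtChartAt_proj p z.2 hz
  rw [secondFundamentalForm_apply, christoffelAt, christoffelAt, extChartAt_tangent_self,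
    he.fderiv_eq, he.self_of_nhds]
  simp

end Projection

/-! ### Traces in adapted bases -/

section Trace

variable {V W : Type*} [NormedAddCommGroup V] [NormedSpace ℝ V]
  [NormedAddCommGroup W] [NormedSpace ℝ W]

theorem sum_smul_orthonormal {ι : Type*} [Fintype ι] [DecidableEq ι] {S : V →L[ℝ] V →L[ℝ] ℝ}
    (e : Module.Basis ι ℝ V) (he : ∀ i j, S (e i) (e j) = if i = j then 1 else 0) (n : V) :
    ∑ j, S n (e j) • e j = n := by
  have : ∀ j, S n (e j) = e.repr n j := by
    intro j
    conv_lhs => rw [← e.sum_repr n, map_sum, sum_apply]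
    simp [he, -Module.Basis.sum_repr]
  simp [this, e.sum_repr]

variable [FiniteDimensional ℝ V]

theorem exists_orthonormal_basis {G : V →L[ℝ] V →L[ℝ] ℝ} (hs : ∀ v w, G v w = G w v)
    (hG : ∀ v, v ≠ 0 → 0 < G v v) :
    ∃ e : Module.Basis (Fin (Module.finrank ℝ V)) ℝ V,
      ∀ i j, G (e i) (e j) = if i = j then 1 else 0 := by
  let B : LinearMap.BilinForm ℝ V :=
    LinearMap.mk₂ ℝ (fun v w => G v w) (by simp) (by simp) (by simp) (by simp)
  have hB : ∀ v w, B v w = G v w := fun v w => rfl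
  obtain ⟨b, hb⟩ := LinearMap.BilinForm.exists_orthogonal_basis (B := B) ⟨fun v w => hs v w⟩
  have hp : ∀ i, 0 < G (b i) (b i) := fun i => hG _ (b.ne_zero i)
  have hu : ∀ i, IsUnit ((Real.sqrt (G (b i) (b i)))⁻¹) := fun i =>
    (inv_ne_zero (Real.sqrt_pos.2 (hp i)).ne').isUnit
  refine ⟨b.isUnitSMul hu, fun i j => ?_⟩
  simp only [Module.Basis.isUnitSMul_apply, map_smul, smul_apply, smul_eq_mul]
  split_ifs with h
  · subst h
    have h1 := Real.mul_self_sqrt (hp i).le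
    have h2 := (Real.sqrt_pos.2 (hp i)).ne'
    field_simp
    rw [pow_two, h1]
  · have : G (b i) (b j) = 0 := hb h
    rw [this, mul_zero, mul_zero]

/-- The trace with respect to a metric on `V × V` for which `{(v, -L v)}` and `{(0, w)}` are
orthogonal. -/
theorem metricTrace_prod {ι κ : Type*} [Fintype ι] [DecidableEq ι] [Fintype κ] [DecidableEq κ]
    {G S : V →L[ℝ] V →L[ℝ] ℝ} (L : V →L[ℝ] V) {h : V × V →L[ℝ] V × V →L[ℝ] ℝ}
    (hpos : ∀ v, v ≠ 0 → 0 < h v v)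
    (hh : ∀ ξ η, h ξ η = G ξ.1 η.1 + S (ξ.2 + L ξ.1) (η.2 + L η.1))
    (e : Module.Basis ι ℝ V) (he : ∀ i j, G (e i) (e j) = if i = j then 1 else 0)
    (s : Module.Basis κ ℝ V) (hs : ∀ i j, S (s i) (s j) = if i = j then 1 else 0)
    (B : V × V →L[ℝ] V × V →L[ℝ] W) :
    metricTrace h B = ∑ i, B (e i, -L (e i)) (e i, -L (e i)) + ∑ j, B (0, s j) (0, s j) := by
  let Φ : (V × V) ≃ₗ[ℝ] V × V :=
    (LinearEquiv.refl ℝ V).skewProd (LinearEquiv.refl ℝ V) (-(L : V →ₗ[ℝ] V))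
  have h1 : ∀ i, (e.prod s).map Φ (Sum.inl i) = (e i, -L (e i)) := fun i => by
    simp [Φ, LinearEquiv.skewProd_apply]
  have h2 : ∀ j, (e.prod s).map Φ (Sum.inr j) = (0, s j) := fun i => by
    simp [Φ, LinearEquiv.skewProd_apply]
  rw [metricTrace_eq_sum_orthonormal hpos B ((e.prod s).map Φ), Fintype.sum_sum_type]
  · simp only [h1, h2]
  · rintro (i | i) (j | j) <;> simp [h1, h2, hh, he, hs]

end Trace

/-! ### The gradient in charts -/

section Gradient

variable {E : Type*} [NormedAddCommGroup E] [NormedSpace ℝ E] [FiniteDimensional ℝ E]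
  {H : Type*} [TopologicalSpace H] {I : ModelWithCorners ℝ E H}
  {M : Type*} [TopologicalSpace M] [ChartedSpace H M]

theorem inner_gradient (g : RiemannianMetric (fun x : M => TangentSpace I x)) (f : M → ℝ) (x : M)
    (v : E) : g.inner x (gradient g f x) v = dirDeriv (I := I) f x v :=
  congrArg (fun T : E →L[ℝ] ℝ => T v) (apply_inverse (V := E) (G := g.inner x) (g.pos x)
    (mfderiv I 𝓘(ℝ, ℝ) f x))

variable [I.Boundaryless] [IsManifold I ∞ M]

omit [FiniteDimensional ℝ E] in
theorem fderiv_chartTransition_chartField (Y : Π x : M, TangentSpace I x) {c : M} {y : E}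
    (hy : y ∈ (extChartAt I c).target) :
    fderiv ℝ (chartTransition I c ((extChartAt I c).symm y)) y (chartField c Y y) =
      Y ((extChartAt I c).symm y) := by
  have h : chartField c Y y = fderiv ℝ (chartTransition I ((extChartAt I c).symm y) c)
      (chartTransition I c ((extChartAt I c).symm y) y) (Y ((extChartAt I c).symm y)) :=
    congrArg (fun T : E →L[ℝ] E => T (Y ((extChartAt I c).symm y)))
      (mfderiv_extChartAt_eq_fderiv ((extChartAt I c).map_target hy))
  rw [h]
  exact fderiv_chartTransition_comp' (mem_overlap_point hy) _

omit [FiniteDimensional ℝ E] in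
theorem chartField_self (Y : Π x : M, TangentSpace I x) (x : M) :
    chartField x Y (extChartAt I x x) = Y x := by
  have h := fderiv_chartTransition_chartField Y (mem_extChartAt_target (I := I) x)
  have h' : ∀ q (_ : q = x),
      fderiv ℝ (chartTransition I x q) (extChartAt I x x) (chartField x Y (extChartAt I x x)) =
        (Y q : E) →
      chartField x Y (extChartAt I x x) = (Y x : E) := by
    rintro q rfl hq
    rwa [fderiv_chartTransition_self (mem_extChartAt_target q)] at hq
  exact h' _ ((extChartAt I x).left_inv (mem_extChartAt_source x)) h

omit [FiniteDimensional ℝ E] in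
theorem chartMetric_chartField (g : RiemannianMetric (fun x : M => TangentSpace I x))
    (Y : Π x : M, TangentSpace I x) {c : M} {y : E} (hy : y ∈ (extChartAt I c).target) (v : E) :
    chartMetric g c y (chartField c Y y) v = g.inner ((extChartAt I c).symm y)
      (Y ((extChartAt I c).symm y))
      (fderiv ℝ (chartTransition I c ((extChartAt I c).symm y)) y v) := by
  rw [chartMetric_apply g hy, fderiv_chartTransition_chartField Y hy]

section

variable (g : ContMDiffRiemannianMetric I ∞ E (fun x : M => TangentSpace I x)) {f : M → ℝ}
  (hf : ContMDiff I 𝓘(ℝ, ℝ) ∞ f) {c : M} {y : E}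

include hf

theorem chartMetric_chartField_gradient (hy : y ∈ (extChartAt I c).target) (v : E) :
    chartMetric g.toRiemannianMetric c y (chartField c (gradient g.toRiemannianMetric f) y) v =
      fderiv ℝ (chartFun I f c) y v := by
  rw [chartMetric_chartField _ _ hy, inner_gradient, dirDeriv_chartTransition hf hy]

theorem contDiffOn_chartField_gradient (c : M) :
    ContDiffOn ℝ ∞ (chartField c (gradient g.toRiemannianMetric f)) (extChartAt I c).target := by
  have hS : ContDiffOn ℝ ∞ (fun z => (chartMetric g.toRiemannianMetric c z).inverse)
      (extChartAt I c).target :=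
    fun z hz => (contDiffAt_inverse_chartMetric g hz).contDiffWithinAt
  have hF : ContDiffOn ℝ ∞ (fderiv ℝ (chartFun I f c)) (extChartAt I c).target :=
    (contDiffOn_chartFun hf c).fderiv_of_isOpen (m := ∞) (isOpen_extChartAt_target c)
      (by norm_cast)
  refine (hS.clm_apply hF).congr fun y hy => chartMetric_ext g.toRiemannianMetric hy fun v => ?_
  rw [chartMetric_chartField_gradient g hf hy, apply_inverse (chartMetric_pos _ hy)]

theorem differentiableAt_chartField_gradient (hy : y ∈ (extChartAt I c).target) :
    DifferentiableAt ℝ (chartField c (gradient g.toRiemannianMetric f)) y :=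
  ((contDiffOn_chartField_gradient g hf c).contDiffAt
    ((isOpen_extChartAt_target c).mem_nhds hy)).differentiableAt (by simp)

/-- The covariant derivative of the gradient is the Hessian. -/
theorem chartMetric_fderiv_chartField_gradient (hy : y ∈ (extChartAt I c).target) (v z : E) :
    chartMetric g.toRiemannianMetric c y
        (fderiv ℝ (chartField c (gradient g.toRiemannianMetric f)) y v +
          christoffel g.toRiemannianMetric c y v
            (chartField c (gradient g.toRiemannianMetric f) y)) z =
      chartHessian g.toRiemannianMetric f c y v z := by
  have h1 := ((differentiableAt_chartMetric g hy).hasFDerivAt.clm_apply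
    (differentiableAt_chartField_gradient g hf hy).hasFDerivAt).clm_apply (hasFDerivAt_const z y)
  have h2 := (differentiableAt_fderiv_chartFun hf hy).hasFDerivAt.clm_apply
    (hasFDerivAt_const z y)
  have he : (fun y => fderiv ℝ (chartFun I f c) y z) =ᶠ[𝓝 y] fun y =>
      chartMetric g.toRiemannianMetric c y
        (chartField c (gradient g.toRiemannianMetric f) y) z := by
    filter_upwards [(isOpen_extChartAt_target c).mem_nhds hy] with w hw
    exact (chartMetric_chartField_gradient g hf hw z).symm
  have h3 := congrArg (fun T : E →L[ℝ] ℝ => T v) (h2.unique (h1.congr_of_eventuallyEq he))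
  simp at h3
  rw [chartHessian, h3, fderiv_chartMetric g hy, chartMetric_chartField_gradient g hf hy,
    map_add, add_apply]
  ring

theorem chartFun_alpha (hy : y ∈ (extChartAt I c).target) :
    chartFun I (alpha g.toRiemannianMetric f) c y =
      1 + fderiv ℝ (chartFun I f c) y (chartField c (gradient g.toRiemannianMetric f) y) := by
  rw [← chartMetric_chartField_gradient g hf hy, chartMetric_chartField _ _ hy,
    fderiv_chartTransition_chartField _ hy]
  rfl

theorem fderiv_chartFun_alpha (hy : y ∈ (extChartAt I c).target) (v : E) :
    fderiv ℝ (chartFun I (alpha g.toRiemannianMetric f) c) y v =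
      2 * chartHessian g.toRiemannianMetric f c y v
        (chartField c (gradient g.toRiemannianMetric f) y) := by
  have h := ((differentiableAt_fderiv_chartFun hf hy).hasFDerivAt.clm_apply
    (differentiableAt_chartField_gradient g hf hy).hasFDerivAt).const_add 1
  have he : chartFun I (alpha g.toRiemannianMetric f) c =ᶠ[𝓝 y] fun y =>
      1 + fderiv ℝ (chartFun I f c) y (chartField c (gradient g.toRiemannianMetric f) y) := by
    filter_upwards [(isOpen_extChartAt_target c).mem_nhds hy] with w hw
    exact chartFun_alpha g hf hw
  have h3 := chartMetric_fderiv_chartField_gradient g hf hy v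
    (chartField c (gradient g.toRiemannianMetric f) y)
  rw [chartMetric_symm, chartMetric_chartField_gradient g hf hy, map_add] at h3
  rw [he.fderiv_eq, h.fderiv]
  simp only [add_apply, ContinuousLinearMap.comp_apply, ContinuousLinearMap.flip_apply]
  rw [chartHessian] at h3 ⊢
  linarith

theorem contMDiff_alpha : ContMDiff I 𝓘(ℝ, ℝ) ∞ (alpha g.toRiemannianMetric f) := by
  intro x
  have hF : ContDiffOn ℝ ∞ (fderiv ℝ (chartFun I f x)) (extChartAt I x).target :=
    (contDiffOn_chartFun hf x).fderiv_of_isOpen (m := ∞) (isOpen_extChartAt_target x)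
      (by norm_cast)
  have h1 : ContDiffOn ℝ ∞ (chartFun I (alpha g.toRiemannianMetric f) x)
      (extChartAt I x).target :=
    (contDiffOn_const.add (hF.clm_apply (contDiffOn_chartField_gradient g hf x))).congr
      fun y hy => chartFun_alpha g hf hy
  have h2 := (h1.contDiffAt ((isOpen_extChartAt_target x).mem_nhds
    (mem_extChartAt_target x))).contMDiffAt.comp x (contMDiffAt_extChartAt (n := ∞))
  refine h2.congr_of_eventuallyEq ?_
  filter_upwards [extChartAt_source_mem_nhds (I := I) x] with z hz
  exact congrArg (alpha g.toRiemannianMetric f) ((extChartAt I x).left_inv hz).symm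

end

omit [FiniteDimensional ℝ E] in
/-- A smooth function with vanishing differential on a connected manifold is constant. -/
theorem eq_of_mfderiv_eq_zero [PreconnectedSpace M] {f : M → ℝ} (hf : ContMDiff I 𝓘(ℝ, ℝ) ∞ f)
    (h0 : ∀ x (v : E), dirDeriv (I := I) f x v = 0) (x y : M) : f x = f y := by
  refine IsLocallyConstant.apply_eq_of_preconnectedSpace
    ((IsLocallyConstant.iff_eventually_eq f).2 fun x => ?_) x y
  obtain ⟨r, hr, hb⟩ := Metric.isOpen_iff.1 (isOpen_extChartAt_target (I := I) x) _
    (mem_extChartAt_target x)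
  have hc : ∀ z ∈ Metric.ball (extChartAt I x x) r,
      chartFun I f x z = chartFun I f x (extChartAt I x x) := fun z hz =>
    Metric.isOpen_ball.is_const_of_fderiv_eq_zero (convex_ball _ _).isPreconnected
      (fun w hw => (differentiableAt_chartFun hf (hb hw)).differentiableWithinAt)
      (fun w hw => ContinuousLinearMap.ext fun v =>
        (dirDeriv_chartTransition hf (hb hw) v).symm.trans (h0 _ _)) hz (Metric.mem_ball_self hr)
  filter_upwards [extChartAt_source_mem_nhds (I := I) x,
    (continuousAt_extChartAt (I := I) x).preimage_mem_nhds (Metric.ball_mem_nhds _ hr)] with z hz hz'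
  have h := hc _ hz'
  rwa [chartFun, chartFun, (extChartAt I x).left_inv hz,
    (extChartAt I x).left_inv (mem_extChartAt_source x)] at h

end Gradient

/-! ### The tension field of the projection -/

section TensionField

variable {E : Type*} [NormedAddCommGroup E] [NormedSpace ℝ E] [FiniteDimensional ℝ E]
  {H : Type*} [TopologicalSpace H] {I : ModelWithCorners ℝ E H} [I.Boundaryless]
  {M : Type*} [TopologicalSpace M] [ChartedSpace H M] [IsManifold I ∞ M]
  (g : ContMDiffRiemannianMetric I ∞ E (fun x : M => TangentSpace I x)) {f : M → ℝ}

omit [FiniteDimensional ℝ E] in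
theorem inner_ext (g : RiemannianMetric (fun x : M => TangentSpace I x)) {x : M}
    {a b : TangentSpace I x} (h : ∀ z : E, g.inner x a z = g.inner x b z) : a = b :=
  chartMetric_ext g (mem_extChartAt_target (I := I) x) fun z =>
    (chartMetric_self g x a z).trans ((h z).trans (chartMetric_self g x b z).symm)

omit [FiniteDimensional ℝ E] [I.Boundaryless] [IsManifold I ∞ M] in
theorem one_le_alpha (g : RiemannianMetric (fun x : M => TangentSpace I x)) (f : M → ℝ) (x : M) :
    1 ≤ alpha g f x := by
  refine le_add_of_nonneg_right ?_
  by_cases hv : gradient g f x = 0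
  · rw [hv, map_zero]
  · exact (g.pos _ _ hv).le

omit [FiniteDimensional ℝ E] [I.Boundaryless] [IsManifold I ∞ M] in
theorem alpha_pos (g : RiemannianMetric (fun x : M => TangentSpace I x)) (f : M → ℝ) (x : M) :
    0 < alpha g f x :=
  one_pos.trans_le (one_le_alpha g f x)

omit [FiniteDimensional ℝ E] [I.Boundaryless] [IsManifold I ∞ M] in
theorem metricNorm_gradient (g : RiemannianMetric (fun x : M => TangentSpace I x)) (f : M → ℝ)
    (x : M) : metricNorm g x (gradient g f x) = Real.sqrt (alpha g f x - 1) := by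
  rw [metricNorm, alpha, add_sub_cancel_left]

variable (hf : ContMDiff I 𝓘(ℝ, ℝ) ∞ f)

include hf

theorem inner_covDeriv_gradient (x : M) (v z : E) :
    g.inner x (covDeriv g.toRiemannianMetric (gradient g.toRiemannianMetric f) x v) z =
      chartHessian g.toRiemannianMetric f x (extChartAt I x x) v z := by
  have h := chartMetric_fderiv_chartField_gradient g hf (mem_extChartAt_target x) v z
  rw [chartField_self, chartMetric_self] at h
  exact h

theorem inner_gradient_alpha (x : M) (z : E) :
    g.inner x (gradient g.toRiemannianMetric (alpha g.toRiemannianMetric f) x) z =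
      2 * chartHessian g.toRiemannianMetric f x (extChartAt I x x) z
        (gradient g.toRiemannianMetric f x) := by
  have h := fderiv_chartFun_alpha g hf (mem_extChartAt_target x) z
  rw [chartField_self] at h
  rw [← h]
  refine (inner_gradient (I := I) g.toRiemannianMetric _ x z).trans ?_
  exact congrArg (fun T : E →L[ℝ] ℝ => T z) (mfderiv_eq_fderiv_chartFun
    ((contMDiff_alpha g hf x).mdifferentiableAt (by simp)))

/-- `grad α = 2 ∇_{grad f} grad f`. -/
theorem gradient_alpha (x : M) :
    gradient g.toRiemannianMetric (alpha g.toRiemannianMetric f) x =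
      (2 : ℝ) • covDeriv g.toRiemannianMetric (gradient g.toRiemannianMetric f) x
        (gradient g.toRiemannianMetric f x) := by
  refine inner_ext g.toRiemannianMetric fun z => ?_
  rw [map_smul]
  refine (inner_gradient_alpha g hf x z).trans ?_
  exact congrArg (fun t => 2 * t)
    ((chartHessian_symm g hf (mem_extChartAt_target x) _ _).trans
      (inner_covDeriv_gradient g hf x _ z).symm)

theorem secondFundamentalForm_proj_horizontal (p : TangentBundle I M) (a : E) :
    secondFundamentalForm (musGradientMetric g.toRiemannianMetric f) g.toRiemannianMetric
      (TotalSpace.proj : TangentBundle I M → M) p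
      ((a, -christoffel g.toRiemannianMetric p.proj (extChartAt I p.proj p.proj) a p.snd) : E × E)
      ((a, -christoffel g.toRiemannianMetric p.proj (extChartAt I p.proj p.proj) a p.snd) : E × E)
      = 0 := by
  rw [secondFundamentalForm_proj, sub_eq_zero]
  exact (christoffel_musGradientMetric_horizontal g hf p p.snd (mem_extChartAt_target p.proj)
    a).symm

theorem secondFundamentalForm_proj_vertical (p : TangentBundle I M) (b z : E) :
    chartMetric g.toRiemannianMetric p.proj (extChartAt I p.proj p.proj)
      (secondFundamentalForm (musGradientMetric g.toRiemannianMetric f) g.toRiemannianMetric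
        (TotalSpace.proj : TangentBundle I M → M) p ((0, b) : E × E) ((0, b) : E × E)) z =
      fderiv ℝ (chartFun I f p.proj) (extChartAt I p.proj p.proj) b *
        chartHessian g.toRiemannianMetric f p.proj (extChartAt I p.proj p.proj) z b := by
  have h0 : christoffel g.toRiemannianMetric p.proj (extChartAt I p.proj p.proj) (0 : E) (0 : E) =
      0 := map_zero _
  rw [secondFundamentalForm_proj, h0, zero_sub, map_neg]
  refine neg_eq_iff_eq_neg.2 ?_
  exact christoffel_musGradientMetric_vertical g hf p p.snd (mem_extChartAt_target p.proj) b z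

theorem chartMetric_tensionField (p : TangentBundle I M) (z : E) :
    chartMetric g.toRiemannianMetric p.proj (extChartAt I p.proj p.proj)
      (tensionField (musGradientMetric g.toRiemannianMetric f) g.toRiemannianMetric
        (TotalSpace.proj : TangentBundle I M → M) p) z =
      (1 / alpha g.toRiemannianMetric f p.proj) *
        chartHessian g.toRiemannianMetric f p.proj (extChartAt I p.proj p.proj) z
          (gradient g.toRiemannianMetric f p.proj) := by
  have hy := mem_extChartAt_target (I := I) p.proj
  set c := p.proj with hc
  set y := extChartAt I c c
  set G := chartMetric g.toRiemannianMetric c y with hG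
  set l : E →L[ℝ] ℝ := fderiv ℝ (chartFun I f c) y with hl
  set n : E := gradient g.toRiemannianMetric f c with hn
  have hGn : ∀ v, G n v = l v := fun v => by
    have h := chartMetric_chartField_gradient g hf hy v
    rwa [chartField_self] at h
  have hα : alpha g.toRiemannianMetric f c = 1 + l n := by
    rw [← hGn, hG, chartMetric_self]
    rfl
  have hα0 := alpha_pos g.toRiemannianMetric f c
  let S : E →L[ℝ] E →L[ℝ] ℝ := G + l.smulRight l
  have hS : ∀ v w, S v w = G v w + l v * l w := fun v w => rfl
  have hGpos : ∀ v, v ≠ 0 → 0 < G v v := chartMetric_pos _ hy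
  obtain ⟨e, he⟩ := exists_orthonormal_basis (chartMetric_symm g.toRiemannianMetric c y) hGpos
  obtain ⟨s, hs⟩ := exists_orthonormal_basis (G := S)
    (fun v w => by rw [hS, hS, hG, chartMetric_symm, mul_comm])
    (fun v hv => by rw [hS]; nlinarith [hGpos v hv, mul_self_nonneg (l v)])
  have hτ : tensionField (musGradientMetric g.toRiemannianMetric f) g.toRiemannianMetric
      (TotalSpace.proj : TangentBundle I M → M) p =
      ∑ j, secondFundamentalForm (musGradientMetric g.toRiemannianMetric f) g.toRiemannianMetric
        (TotalSpace.proj : TangentBundle I M → M) p ((0, s j) : E × E) ((0, s j) : E × E) := by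
    refine (metricTrace_prod (V := E) (W := E) (G := G) (S := S)
      ((christoffel g.toRiemannianMetric c y).flip p.snd)
      (h := (musGradientMetric g.toRiemannianMetric f).inner p)
      (musGradientForm_pos g.toRiemannianMetric f p) ?_ e he s hs _).trans ?_
    · intro ξ η
      refine (chartMetric_self (E := E × E) (musGradientMetric g.toRiemannianMetric f) p ξ η
        ).symm.trans ?_
      rw [extChartAt_tangent_self]
      exact chartMetric_musGradientMetric g hf p p.snd hy ξ.1 ξ.2 η.1 η.2
    · rw [Finset.sum_eq_zero, zero_add]
      exact fun i _ => secondFundamentalForm_proj_horizontal g hf p (e i)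
  have hsum : ∑ j, l (s j) • s j = (1 / alpha g.toRiemannianMetric f c) • n := by
    rw [← sum_smul_orthonormal s hs ((1 / alpha g.toRiemannianMetric f c) • n)]
    refine Finset.sum_congr rfl fun j _ => ?_
    congr 1
    rw [map_smul, smul_apply, hS, hGn, smul_eq_mul, hα]
    rw [hα] at hα0
    field_simp
  let B : E →L[ℝ] ℝ := fderiv ℝ (fderiv ℝ (chartFun I f c)) y z -
    l ∘L christoffel g.toRiemannianMetric c y z
  have hB : ∀ v, chartHessian g.toRiemannianMetric f c y z v = B v := fun v => rfl
  rw [hτ, map_sum, sum_apply]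
  calc _ = ∑ j, l (s j) * B (s j) :=
        Finset.sum_congr rfl fun j _ => secondFundamentalForm_proj_vertical g hf p (s j) z
    _ = B (∑ j, l (s j) • s j) := by simp
    _ = _ := by rw [hsum, map_smul, hB, smul_eq_mul]

theorem tensionField_proj (p : TangentBundle I M) :
    tensionField (musGradientMetric g.toRiemannianMetric f) g.toRiemannianMetric
        (TotalSpace.proj : TangentBundle I M → M) p =
      (1 / alpha g.toRiemannianMetric f p.proj) •
        covDeriv g.toRiemannianMetric (gradient g.toRiemannianMetric f) p.proj
          (gradient g.toRiemannianMetric f p.proj) := by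
  have hy := mem_extChartAt_target (I := I) p.proj
  refine inner_ext g.toRiemannianMetric fun z => ?_
  refine (chartMetric_self g.toRiemannianMetric _ _ _).symm.trans
    ((chartMetric_tensionField g hf p z).trans ?_)
  rw [map_smul]
  exact congrArg (fun t => (1 / alpha g.toRiemannianMetric f p.proj) * t)
    ((chartHessian_symm g hf hy _ _).trans (inner_covDeriv_gradient g hf p.proj _ z).symm)

theorem tensionField_proj_eq_gradient_alpha (p : TangentBundle I M) :
    tensionField (musGradientMetric g.toRiemannianMetric f) g.toRiemannianMetric
        (TotalSpace.proj : TangentBundle I M → M) p =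
      (1 / (2 * alpha g.toRiemannianMetric f p.proj)) •
        gradient g.toRiemannianMetric (alpha g.toRiemannianMetric f) p.proj := by
  rw [tensionField_proj g hf, gradient_alpha g hf, smul_smul]
  congr 1
  have := (alpha_pos g.toRiemannianMetric f p.proj).ne'
  field_simp

theorem isHarmonic_proj_iff [PreconnectedSpace M] :
    IsHarmonic (musGradientMetric g.toRiemannianMetric f) g.toRiemannianMetric
        (TotalSpace.proj : TangentBundle I M → M) ↔
      ∃ c : ℝ, ∀ x : M, metricNorm g.toRiemannianMetric x
        (gradient g.toRiemannianMetric f x) = c := by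
  constructor
  · rintro ⟨-, h⟩
    have h0 : ∀ x (v : E), dirDeriv (I := I) (alpha g.toRiemannianMetric f) x v = 0 := by
      intro x v
      have h1 := tensionField_proj_eq_gradient_alpha g hf ⟨x, 0⟩
      rw [h] at h1
      have h2 : gradient g.toRiemannianMetric (alpha g.toRiemannianMetric f) x = 0 :=
        (smul_eq_zero.1 h1.symm).resolve_left
          (one_div_pos.2 (mul_pos two_pos (alpha_pos g.toRiemannianMetric f x))).ne'
      rw [← inner_gradient g.toRiemannianMetric, h2, map_zero]
      rfl
    obtain hM | ⟨⟨x⟩⟩ := isEmpty_or_nonempty M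
    · exact ⟨0, fun x => isEmptyElim x⟩
    · refine ⟨Real.sqrt (alpha g.toRiemannianMetric f x - 1), fun z => ?_⟩
      rw [metricNorm_gradient, eq_of_mfderiv_eq_zero (contMDiff_alpha g hf) h0 z x]
  · rintro ⟨c, hc⟩
    refine ⟨contMDiff_proj _, fun p => ?_⟩
    have h1 : alpha g.toRiemannianMetric f = fun _ => 1 + c ^ 2 := by
      funext x
      rw [← hc x, metricNorm_gradient, Real.sq_sqrt (sub_nonneg.2 (one_le_alpha _ _ _)),
        add_sub_cancel]
    rw [tensionField_proj_eq_gradient_alpha g hf]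
    have h2 : gradient g.toRiemannianMetric (alpha g.toRiemannianMetric f) p.proj = 0 := by
      rw [gradient, h1, mfderiv_const]
      exact map_zero _
    rw [h2, smul_zero]

end TensionField

end RiemGeom

end

theorem theorem4p1
    {E : Type*} [NormedAddCommGroup E] [NormedSpace ℝ E] [FiniteDimensional ℝ E]
    {H : Type*} [TopologicalSpace H] (I : ModelWithCorners ℝ E H) [I.Boundaryless]
    {M : Type*} [TopologicalSpace M] [ChartedSpace H M] [IsManifold I ∞ M]
    (g : ContMDiffRiemannianMetric I ∞ E (fun x : M => TangentSpace I x))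
    (f : M → ℝ) (hf : ContMDiff I 𝓘(ℝ, ℝ) ∞ f) (hpos : ∀ x, 0 < f x) :
    (∀ p : TangentBundle I M,
      RiemGeom.tensionField (RiemGeom.musGradientMetric g.toRiemannianMetric f)
          g.toRiemannianMetric (Bundle.TotalSpace.proj : TangentBundle I M → M) p =
        (1 / RiemGeom.alpha g.toRiemannianMetric f p.proj) •
          RiemGeom.covDeriv g.toRiemannianMetric (RiemGeom.gradient g.toRiemannianMetric f) p.proj
            (RiemGeom.gradient g.toRiemannianMetric f p.proj) ∧
      RiemGeom.tensionField (RiemGeom.musGradientMetric g.toRiemannianMetric f)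
          g.toRiemannianMetric (Bundle.TotalSpace.proj : TangentBundle I M → M) p =
        (1 / (2 * RiemGeom.alpha g.toRiemannianMetric f p.proj)) •
          RiemGeom.gradient g.toRiemannianMetric (RiemGeom.alpha g.toRiemannianMetric f) p.proj) ∧
    (PreconnectedSpace M →
      (RiemGeom.IsHarmonic (RiemGeom.musGradientMetric g.toRiemannianMetric f)
          g.toRiemannianMetric (Bundle.TotalSpace.proj : TangentBundle I M → M) ↔
        ∃ c : ℝ, ∀ x : M, RiemGeom.metricNorm g.toRiemannianMetric x
          (RiemGeom.gradient g.toRiemannianMetric f x) = c)) := by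
  refine ⟨fun p => ⟨RiemGeom.tensionField_proj g hf p,
    RiemGeom.tensionField_proj_eq_gradient_alpha g hf p⟩, fun hM => ?_⟩
  exact RiemGeom.isHarmonic_proj_iff g hf
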